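/- Let $m\ge 0$ be an integer, $n=24m+8$, and let $C\subseteq\mathbb F_2^n$ be an extremal binary doubly even self-dual code of length $n$, that is, $C$ is linear, $C=C^\perp$, every weight of $C$ is divisible by $4$, and the minimum weight of $C$ is $4\lfloor n/24\rfloor+4=4m+4$. For a weight $w$ with $w\equiv 0\pmod 4$ and $4m+4\le w\le n-(4m+4)$, let $D_w$ be the support design of $C$: its points are the $n$ coordinates, and its blocks are the supports of the codewords of weight $w$. "All weights" below means all such $w$. A set $\mathcal B$ of $w$-subsets of $\Omega=\{1,\dots,n\}$ is a $t$-design if there is $\lambda$ such that any $t$ points lie in precisely $\lambda$ blocks. For $k\ge 0$ let $\mathrm{Harm}_k$ be the space of real functions $f$ on the $k$-subsets of $\Omega$ with $\sum_{z\supset y,\,|z|=k}f(z)=0$ for all $(k-1)$-subsets $y$, and put $\tilde f(u)=\sum_{z\subseteq u,\,|z|=k}f(z)$ for $u\subseteq\Omega$. For a set $T$ of positive integers, $\mathcal B$ is a $T$-design if $\sum_{b\in\mathcal B}\tilde f(b)=0$ for all $k\in T$ and all $f\in\mathrm{Harm}_k$. The designs $D_w$ for a set of weights are "$t$-designs or not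 simultaneously" if either all of them are $t$-designs or none of them is. Then the following hold. 1. (i) If $m\neq 4$, the $D_w$ of all weights $w$ are $6$-designs or not simultaneously. (ii) If $m=4$ (so $n=104$), $D_w$ is a $\{1,2,3,5\}$-design for every weight $w\ne 24$, and $D_{24}$ is a $\{1,2,3,5,6\}$-design. 2. (i) The $D_w$ of all weights $w\neq 12m+4$ are $7$-designs or not simultaneously. (ii) The middle-weight design $D_{12m+4}$ is a $\{1,2,3,5,7\}$-design. 3. (i) If $m\neq 8$, the $D_w$ of all weights $w$ are $8$-designs or not simultaneously. (ii) If $m=8$ (so $n=200$), $D_w$ is a $\{1,2,3,5\}$-design for every weight $w\neq 40$, and $D_{40}$ is a $\{1,2,3,5,8\}$-design. -/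

import Mathlib

open Finset Matrix

noncomputable section

namespace SupportDesign

section Codes

variable {n : ℕ}

/-- A binary linear code of length `n` is self-dual if it equals its dual with respect to the
standard bilinear form on `𝔽₂ⁿ`. -/
def IsSelfDual (C : Submodule (ZMod 2) (Fin n → ZMod 2)) : Prop :=
  ∀ x : Fin n → ZMod 2, x ∈ C ↔ ∀ y ∈ C, x ⬝ᵥ y = 0

/-- A binary code is doubly even if all its (Hamming) weights are divisible by `4`. -/
def IsDoublyEven (C : Submodule (ZMod 2) (Fin n → ZMod 2)) : Prop :=
  ∀ c ∈ C, 4 ∣ hammingNorm c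

/-- The minimum weight of `C` exists and equals `d`. -/
def HasMinWeight (C : Submodule (ZMod 2) (Fin n → ZMod 2)) (d : ℕ) : Prop :=
  IsLeast {w : ℕ | ∃ c ∈ C, c ≠ 0 ∧ hammingNorm c = w} d

/-- Extremal binary doubly even self-dual codes: the minimum weight is `4⌊n/24⌋ + 4`. -/
structure IsExtremalTypeII (C : Submodule (ZMod 2) (Fin n → ZMod 2)) : Prop where
  selfDual : IsSelfDual C
  doublyEven : IsDoublyEven C
  minWeight : HasMinWeight C (4 * (n / 24) + 4)

/-- The support of a word: the set of indices of its nonzero coordinates. -/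
def supp (c : Fin n → ZMod 2) : Finset (Fin n) := {i | c i ≠ 0}

open Classical in
/-- The blocks of the support design `D_w` of `C`: the supports of all codewords of weight `w`. -/
def supportDesign (C : Submodule (ZMod 2) (Fin n → ZMod 2)) (w : ℕ) :
    Finset (Finset (Fin n)) :=
  {B | ∃ c ∈ C, hammingNorm c = w ∧ supp c = B}

/-- The weights `w` for which the support design `D_w` is considered:
`w ≡ 0 (mod 4)` and `4⌊n/24⌋ + 4 ≤ w ≤ n - (4⌊n/24⌋ + 4)`. -/
def IsDesignWeight (n w : ℕ) : Prop :=
  4 ∣ w ∧ 4 * (n / 24) + 4 ≤ w ∧ w + (4 * (n / 24) + 4) ≤ n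

end Codes

section Designs

variable {Ω : Type*} [Fintype Ω] [DecidableEq Ω]

/-- `𝓑` is the block set of a `t`-`(v, k, l)` design on `Ω` (with `v = |Ω|`) for some `l`:
all blocks have `k` elements and any `t` points lie in precisely `l` blocks. -/
def IsDesign (t k : ℕ) (𝓑 : Finset (Finset Ω)) : Prop :=
  (∀ B ∈ 𝓑, #B = k) ∧
    ∃ l : ℕ, ∀ S : Finset Ω, #S = t → #{B ∈ 𝓑 | S ⊆ B} = l

/-- The differentiation operator `γ` on the free real vector space on the subsets of `Ω`
(elements of which are written as functions `Finset Ω → ℝ`). It sends a `k`-subset `z` to the sum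
of the `(k-1)`-subsets `y ⊆ z`, so the coefficient of `γ f` at `y` is the sum of `f z` over all
`z ⊇ y` with `|z| = |y| + 1`. -/
def gamma : (Finset Ω → ℝ) →ₗ[ℝ] (Finset Ω → ℝ) where
  toFun f y := ∑ z : Finset Ω with y ⊆ z ∧ #z = #y + 1, f z
  map_add' f g := by
    funext y
    simp [Finset.sum_add_distrib]
  map_smul' a f := by
    funext y
    simp [Finset.mul_sum]

/-- `f` lies in `Harm_k`: it is supported on the `k`-subsets and is killed by `γ`. -/
def IsHarmonic (k : ℕ) (f : Finset Ω → ℝ) : Prop :=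
  (∀ z : Finset Ω, #z ≠ k → f z = 0) ∧ gamma f = 0

/-- The extension `f̃(u) = ∑_{z ⊆ u, |z| = k} f(z)` of a function `f` on `k`-subsets. -/
def extend (k : ℕ) (f : Finset Ω → ℝ) (u : Finset Ω) : ℝ :=
  ∑ z ∈ u.powersetCard k, f z

/-- A set `𝓑` of `w`-subsets of `Ω` is a `T`-design if `∑_{b ∈ 𝓑} f̃(b) = 0` for all `k ∈ T` and
all `f ∈ Harm_k`. -/
def IsTDesign (T : Set ℕ) (w : ℕ) (𝓑 : Finset (Finset Ω)) : Prop :=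
  (∀ B ∈ 𝓑, #B = w) ∧
    ∀ k ∈ T, ∀ f : Finset Ω → ℝ, IsHarmonic k f → ∑ B ∈ 𝓑, extend k f B = 0

end Designs

/-- The support designs `D_w` of `C` with `w` in `S` are `t`-designs or not simultaneously:
either all of them are `t`-designs or none of them is. -/
def Simultaneously {n : ℕ} (C : Submodule (ZMod 2) (Fin n → ZMod 2)) (t : ℕ) (S : Set ℕ) : Prop :=
  (∀ w ∈ S, IsDesign t w (supportDesign C w)) ∨ (∀ w ∈ S, ¬ IsDesign t w (supportDesign C w))

end SupportDesign

end

namespace SupportDesign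

/-! ### Extensions of functions on k-subsets -/

section Extend

/-! For t ≤ w, a family of w-subsets is a t-design exactly when harmonic functions of degrees 1, …,
t sum to zero over its blocks (`isDesign_of_harmonic`, `IsDesign.sum_extend_eq_zero`). For f
harmonic of degree k, the weight enumerator weighted by f̃ obeys a MacWilliams identity
(`macWilliams`). Extremality gives it the form t^(4m+4) p(t^4) with deg p ≤ 4m, and the identity
then forces (1 - X)^(4m+4-k) to divide p. So p = 0 for k < 4; for 4 ≤ k ≤ 8 and m > 0 the quotient
has degree at most k - 4 and is again invariant, which makes it zero for k = 5 and determines it up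
to a scalar otherwise.

Thus, for k = 4, 6, 7, 8, the block sums of f at all weights are one scalar r, depending on f only,
times a nonzero constant times an explicit integer: 1, `factorSix`, `factorSeven` or `factorEight`.
If the sums vanish at a weight whose integer is nonzero, then r = 0 and they vanish at every weight.
A zero of the integer gives the extra degree of the exceptional T-designs.

It remains to control the zeros. For m > 0, `factorSeven` vanishes only at the middle weight. For
degrees 6 and 8, a t-design with 4 ≤ t ≤ 8 at any weight makes the minimum weight words a 4-design,
so 24m + 5 divides (6m+1) C(5m, m). Residue calculus gives the numbers of words of weights 4m + 4
and 4m + 8; the latter would be negative for m ≥ 159 (`IsExtremalTypeII.lt_of_card_next`). The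
finite check `list_check` shows that, for the remaining m, this divisibility excludes zeros of both
factors and also any 8-design. For m = 0 there is only one weight. -/

theorem extend_of_card_lt {Ω : Type*} {k : ℕ} (f : Finset Ω → ℝ) {B : Finset Ω} (hB : #B < k) :
    extend k f B = 0 := by
  rw [extend, powersetCard_eq_empty.2 hB, sum_empty]

theorem extend_empty {Ω : Type*} {k : ℕ} (hk : k ≠ 0) (f : Finset Ω → ℝ) :
    extend k f ∅ = 0 :=
  extend_of_card_lt f (by simpa using Nat.pos_of_ne_zero hk)

theorem extend_zero_single {Ω : Type*} [DecidableEq Ω] (u : Finset Ω) :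
    extend 0 (fun z : Finset Ω => if z = ∅ then (1 : ℝ) else 0) u = 1 := by
  simp [extend]

end Extend

/-! ### Harmonic functions as translation-invariant multilinear forms -/

section Harmonic

variable {Ω : Type*} [Fintype Ω] [DecidableEq Ω]

theorem sum_supersets_card_succ (f : Finset Ω → ℝ) (y : Finset Ω) :
    ∑ z : Finset Ω with y ⊆ z ∧ #z = #y + 1, f z = ∑ i ∈ yᶜ, f (insert i y) := by
  symm
  refine Finset.sum_bij (fun i _ => insert i y) ?_ ?_ ?_ ?_
  · intro i hi
    rw [mem_compl] at hi
    simp [hi, subset_insert]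
  · intro i hi j hj h
    rw [mem_compl] at hi hj
    have : i ∈ insert j y := h ▸ mem_insert_self i y
    rcases mem_insert.1 this with h | h
    · exact h
    · exact absurd h hi
  · intro z hz
    simp only [mem_filter, mem_univ, true_and] at hz
    obtain ⟨i, hi⟩ : ∃ i, i ∈ z \ y := by
      rw [← Finset.Nonempty, ← card_pos, card_sdiff_of_subset hz.1]; omega
    rw [mem_sdiff] at hi
    refine ⟨i, by simpa using hi.2, ?_⟩
    refine eq_of_subset_of_card_le (insert_subset hi.1 hz.1) ?_
    rw [card_insert_of_notMem hi.2]; omega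
  · intros; rfl

theorem gamma_apply (f : Finset Ω → ℝ) (y : Finset Ω) :
    gamma f y = ∑ i ∈ yᶜ, f (insert i y) :=
  sum_supersets_card_succ f y

theorem sum_sum_erase (F : Finset Ω → Finset Ω → ℝ) :
    ∑ z : Finset Ω, ∑ i ∈ z, F z (z.erase i) = ∑ y : Finset Ω, ∑ i ∈ yᶜ, F (insert i y) y := by
  rw [Finset.sum_sigma', Finset.sum_sigma']
  refine Finset.sum_bij' (fun p _ => ⟨p.1.erase p.2, p.2⟩) (fun p _ => ⟨insert p.2 p.1, p.2⟩)
    ?_ ?_ ?_ ?_ ?_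
  · rintro ⟨z, i⟩ h; simp
  · rintro ⟨z, i⟩ h; simp
  · rintro ⟨z, i⟩ h
    simp only [mem_sigma, mem_univ, true_and] at h
    simp [insert_erase h]
  · rintro ⟨z, i⟩ h
    simp only [mem_sigma, mem_univ, true_and, mem_compl] at h
    simp [erase_insert h]
  · rintro ⟨z, i⟩ h
    simp only [mem_sigma, mem_univ, true_and] at h
    simp [insert_erase h]

/-- Pairing `f` with a function lifted from subsets of one element less. -/
theorem sum_mul_sum_erase (f g : Finset Ω → ℝ) :
    ∑ z : Finset Ω, f z * ∑ i ∈ z, g (z.erase i) = ∑ y : Finset Ω, gamma f y * g y := by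
  simp_rw [Finset.mul_sum, gamma_apply, Finset.sum_mul]
  exact sum_sum_erase fun z y => f z * g y

/-- The multilinear form attached to a function on subsets. -/
def multilin (f : Finset Ω → ℝ) (θ : Ω → ℝ) : ℝ := ∑ z : Finset Ω, f z * ∏ i ∈ z, θ i

/-- The derivative in c pairs `gamma f` with products of the shifted variables, so it vanishes
identically. -/
theorem IsHarmonic.multilin_add_const {k : ℕ} {f : Finset Ω → ℝ} (hf : IsHarmonic k f)
    (θ : Ω → ℝ) (c : ℝ) : multilin f (fun i => θ i + c) = multilin f θ := by
  have hd : ∀ c : ℝ, HasDerivAt (fun c => multilin f (fun i => θ i + c)) 0 c := by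
    intro c
    have h1 : HasDerivAt (fun c => multilin f (fun i => θ i + c))
        (∑ z : Finset Ω, f z * ∑ i ∈ z, (∏ j ∈ z.erase i, (θ j + c)) • (1 : ℝ)) c := by
      unfold multilin
      refine HasDerivAt.fun_sum fun z _ => HasDerivAt.const_mul _ ?_
      exact HasDerivAt.fun_finsetProd fun i _ => (hasDerivAt_id c).const_add (θ i)
    convert h1 using 1
    simp only [smul_eq_mul, mul_one]
    rw [sum_mul_sum_erase f fun y => ∏ j ∈ y, (θ j + c), hf.2]
    simp
  have := is_const_of_deriv_eq_zero (fun c => (hd c).differentiableAt) (fun c => (hd c).deriv) c 0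
  simpa using this

theorem IsHarmonic.multilin_const_mul {k : ℕ} {f : Finset Ω → ℝ} (hf : IsHarmonic k f)
    (c : ℝ) (θ : Ω → ℝ) : multilin f (fun i => c * θ i) = c ^ k * multilin f θ := by
  unfold multilin
  rw [Finset.mul_sum]
  refine Finset.sum_congr rfl fun z _ => ?_
  by_cases hz : #z = k
  · rw [Finset.prod_mul_distrib, Finset.prod_const, hz]; ring
  · simp [hf.1 z hz]

theorem IsHarmonic.extend_eq_multilin {k : ℕ} {f : Finset Ω → ℝ} (hf : IsHarmonic k f)
    (u : Finset Ω) : extend k f u = multilin f (fun i => if i ∈ u then 1 else 0) := by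
  unfold extend multilin
  have h : ∀ z : Finset Ω, (∏ i ∈ z, if i ∈ u then (1 : ℝ) else 0) = if z ⊆ u then 1 else 0 := by
    intro z
    rw [Finset.prod_ite_zero]
    simp [subset_iff]
  simp_rw [h, mul_ite, mul_one, mul_zero, ← Finset.sum_filter]
  refine Finset.sum_subset_zero_on_sdiff ?_ ?_ fun _ _ => rfl
  · intro z hz; simp [(mem_powersetCard.1 hz).1]
  · intro z hz
    simp only [mem_sdiff, mem_filter, mem_univ, true_and, mem_powersetCard, not_and] at hz
    exact hf.1 z (hz.2 hz.1)

/-- Translation by q and scaling by p - q reduce to the indicator of u. This is what makes a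
coordinatewise Fourier transform return a multiple of f̃. -/
theorem IsHarmonic.multilin_two_valued {k : ℕ} {f : Finset Ω → ℝ} (hf : IsHarmonic k f)
    (u : Finset Ω) (p q : ℝ) :
    multilin f (fun i => if i ∈ u then p else q) = (p - q) ^ k * extend k f u := by
  rw [hf.extend_eq_multilin, ← hf.multilin_const_mul,
    ← hf.multilin_add_const (fun i => (p - q) * if i ∈ u then 1 else 0) q]
  congr 1
  funext i
  split_ifs <;> ring

theorem IsHarmonic.extend_compl {k : ℕ} {f : Finset Ω → ℝ} (hf : IsHarmonic k f)
    (u : Finset Ω) : extend k f uᶜ = (-1) ^ k * extend k f u := by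
  rw [hf.extend_eq_multilin uᶜ, show (-1 : ℝ) = 0 - 1 by ring, ← hf.multilin_two_valued]
  simp [mem_compl, ite_not]

theorem IsHarmonic.extend_univ {k : ℕ} (hk : k ≠ 0) {f : Finset Ω → ℝ} (hf : IsHarmonic k f) :
    extend k f univ = 0 := by
  rw [← compl_empty, hf.extend_compl, extend_empty hk, mul_zero]

theorem IsHarmonic.sum_eq_zero {k : ℕ} (hk : k ≠ 0) {f : Finset Ω → ℝ} (hf : IsHarmonic k f) :
    ∑ z : Finset Ω, f z = 0 := by
  have := hf.extend_eq_multilin univ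
  rw [hf.extend_univ hk] at this
  simpa [multilin] using this.symm

/-- The function which is `1` on the empty set and `0` elsewhere. -/
theorem isHarmonic_zero_single : IsHarmonic 0 (fun z : Finset Ω => if z = ∅ then (1 : ℝ) else 0) := by
  refine ⟨fun z hz => if_neg fun h => hz (by simp [h]), ?_⟩
  funext y
  rw [gamma_apply]
  simp

end Harmonic

/-! ### Designs and harmonic functions -/

section Designs

variable {Ω : Type*} [Fintype Ω] [DecidableEq Ω]

/-- The number of blocks containing a given set. -/
def cov (𝓑 : Finset (Finset Ω)) (S : Finset Ω) : ℕ := #{B ∈ 𝓑 | S ⊆ B}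

theorem sum_extend (𝓑 : Finset (Finset Ω)) {k : ℕ} {f : Finset Ω → ℝ} (hf : IsHarmonic k f) :
    ∑ B ∈ 𝓑, extend k f B = ∑ S : Finset Ω, f S * cov 𝓑 S := by
  have h : ∀ B : Finset Ω, extend k f B = ∑ S : Finset Ω, f S * if S ⊆ B then 1 else 0 := by
    intro B
    unfold extend
    simp_rw [mul_ite, mul_one, mul_zero, ← Finset.sum_filter]
    refine Finset.sum_subset_zero_on_sdiff ?_ ?_ fun _ _ => rfl
    · intro z hz; simp [(mem_powersetCard.1 hz).1]
    · intro z hz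
      simp only [mem_sdiff, mem_filter, mem_univ, true_and, mem_powersetCard, not_and] at hz
      exact hf.1 z (hz.2 hz.1)
  simp_rw [h]
  rw [Finset.sum_comm]
  refine Finset.sum_congr rfl fun S _ => ?_
  rw [← Finset.mul_sum, cov, Finset.sum_boole]

/-- Count pairs (i, B) with S ⊆ B and i ∈ B \ S. Truncated subtraction is harmless: no block
contains S if #S > w. -/
theorem sum_cov_insert {𝓑 : Finset (Finset Ω)} {w : ℕ} (hB : ∀ B ∈ 𝓑, #B = w) (S : Finset Ω) :
    ∑ i ∈ Sᶜ, cov 𝓑 (insert i S) = (w - #S) * cov 𝓑 S := by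
  simp_rw [cov, Finset.card_filter]
  rw [Finset.sum_comm, Finset.mul_sum]
  refine Finset.sum_congr rfl fun B hBm => ?_
  by_cases h : S ⊆ B
  · simp only [insert_subset_iff, h, and_true, if_true, mul_one]
    rw [← Finset.card_filter, ← hB B hBm, ← card_sdiff_of_subset h]
    congr 1
    ext i
    simp [and_comm]
  · simp [insert_subset_iff, h]

theorem sum_cov_insert_real {𝓑 : Finset (Finset Ω)} {w : ℕ} (hB : ∀ B ∈ 𝓑, #B = w)
    {S : Finset Ω} (hS : #S ≤ w) :
    ∑ i ∈ Sᶜ, (cov 𝓑 (insert i S) : ℝ) = ((w : ℝ) - #S) * cov 𝓑 S := by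
  have := congrArg (Nat.cast : ℕ → ℝ) (sum_cov_insert hB S)
  push_cast [Nat.cast_sub hS] at this
  exact this

theorem IsDesign.pred {t w : ℕ} {𝓑 : Finset (Finset Ω)} (h : IsDesign (t + 1) w 𝓑)
    (htw : t < w) : IsDesign t w 𝓑 := by
  obtain ⟨hB, l, hl⟩ := h
  refine ⟨hB, (Fintype.card Ω - t) * l / (w - t), fun S hS => ?_⟩
  have h1 := sum_cov_insert hB S
  have h2 : ∀ i ∈ Sᶜ, cov 𝓑 (insert i S) = l := fun i hi => by
    refine hl _ ?_
    rw [card_insert_of_notMem (mem_compl.1 hi), hS]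
  rw [Finset.sum_congr rfl h2, sum_const, card_compl, hS, smul_eq_mul] at h1
  rw [h1, Nat.mul_div_cancel_left _ (by omega)]
  rfl

theorem IsDesign.mono {s t w : ℕ} {𝓑 : Finset (Finset Ω)} (h : IsDesign t w 𝓑) (hst : s ≤ t)
    (htw : t ≤ w) : IsDesign s w 𝓑 := by
  induction t, hst using Nat.le_induction with
  | base => exact h
  | succ t _ ih => exact ih (h.pred htw) (by omega)

theorem IsDesign.sum_extend_eq_zero {k t w : ℕ} {𝓑 : Finset (Finset Ω)} (h : IsDesign t w 𝓑)
    (hk : k ≠ 0) (hkt : k ≤ t) (htw : t ≤ w) {f : Finset Ω → ℝ} (hf : IsHarmonic k f) :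
    ∑ B ∈ 𝓑, extend k f B = 0 := by
  obtain ⟨-, l, hl⟩ := h.mono hkt htw
  rw [sum_extend 𝓑 hf]
  have : ∀ S : Finset Ω, f S * cov 𝓑 S = f S * l := fun S => by
    by_cases hS : #S = k
    · rw [cov, hl S hS]
    · rw [hf.1 S hS, zero_mul, zero_mul]
  rw [Finset.sum_congr rfl fun S _ => this S, ← Finset.sum_mul, hf.sum_eq_zero hk, zero_mul]

theorem isHarmonic_of_gamma {k : ℕ} {f : Finset Ω → ℝ} (h0 : ∀ z : Finset Ω, #z ≠ k + 1 → f z = 0)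
    (h : ∀ y : Finset Ω, #y = k → ∑ i ∈ yᶜ, f (insert i y) = 0) : IsHarmonic (k + 1) f := by
  refine ⟨h0, funext fun y => ?_⟩
  rw [gamma_apply]
  by_cases hy : #y = k
  · exact h y hy
  · refine Finset.sum_eq_zero fun i hi => h0 _ ?_
    rw [card_insert_of_notMem (mem_compl.1 hi)]; omega

/-- If all blocks have size `w` and the covering numbers of `k`-sets are constant, then the
deviation of the covering numbers of `k+1`-sets from their mean is harmonic. -/
theorem IsDesign.isHarmonic_cov {k w : ℕ} {𝓑 : Finset (Finset Ω)} (hB : ∀ B ∈ 𝓑, #B = w)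
    (hkw : k ≤ w) (hkn : k < Fintype.card Ω) {l : ℝ}
    (hl : ∀ S : Finset Ω, #S = k → (cov 𝓑 S : ℝ) = l) :
    IsHarmonic (k + 1) fun S : Finset Ω => if #S = k + 1 then
      (cov 𝓑 S : ℝ) - ((w : ℝ) - k) / ((Fintype.card Ω : ℝ) - k) * l else 0 := by
  refine isHarmonic_of_gamma (fun z hz => if_neg hz) fun y hy => ?_
  have hc : ∀ i ∈ yᶜ, #(insert i y) = k + 1 := fun i hi => by
    rw [card_insert_of_notMem (mem_compl.1 hi), hy]
  rw [Finset.sum_congr rfl fun i hi => if_pos (hc i hi), Finset.sum_sub_distrib,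
    sum_cov_insert_real hB (hy ▸ hkw), hl y hy, sum_const, card_compl, hy, nsmul_eq_mul,
    Nat.cast_sub hkn.le]
  have : (Fintype.card Ω : ℝ) - k ≠ 0 := by
    rw [sub_ne_zero]; exact_mod_cast hkn.ne'
  field_simp
  ring

/-- By induction, the deviation of the covering numbers of (t+1)-sets from their mean is itself
harmonic. Testing the hypothesis on this function shows that its sum of squares is zero. -/
theorem isDesign_of_harmonic {t w : ℕ} {𝓑 : Finset (Finset Ω)} (hB : ∀ B ∈ 𝓑, #B = w)
    (htw : t ≤ w)
    (h : ∀ k, 1 ≤ k → k ≤ t → ∀ f : Finset Ω → ℝ, IsHarmonic k f → ∑ B ∈ 𝓑, extend k f B = 0) :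
    IsDesign t w 𝓑 := by
  induction t with
  | zero =>
    refine ⟨hB, #𝓑, fun S hS => ?_⟩
    rw [card_eq_zero] at hS
    simp [hS]
  | succ t ih =>
    obtain ⟨-, l, hl⟩ := ih (by omega) fun k h1 h2 => h k h1 (by omega)
    by_cases htn : t < Fintype.card Ω
    swap
    · refine ⟨hB, 0, fun S hS => ?_⟩
      have := card_le_univ S
      omega
    have hf := IsDesign.isHarmonic_cov hB (by omega) htn (l := l)
      fun S hS => by exact_mod_cast hl S hS
    set c : ℝ := ((w : ℝ) - t) / ((Fintype.card Ω : ℝ) - t) * l with hc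
    set f : Finset Ω → ℝ := fun S => if #S = t + 1 then (cov 𝓑 S : ℝ) - c else 0 with hfdef
    have h1 := h (t + 1) (by omega) le_rfl f hf
    rw [sum_extend 𝓑 hf] at h1
    have h2 : ∑ S : Finset Ω, f S * f S = 0 := by
      have h3 : ∀ S : Finset Ω, f S * f S = f S * cov 𝓑 S - f S * c := fun S => by
        simp only [hfdef]
        split_ifs <;> ring
      rw [Finset.sum_congr rfl fun S _ => h3 S, Finset.sum_sub_distrib, h1, ← Finset.sum_mul,
        hf.sum_eq_zero (by omega), zero_mul, sub_zero]
    have h4 : ∀ S : Finset Ω, #S = t + 1 → (cov 𝓑 S : ℝ) = c := fun S hS => by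
      have := (Finset.sum_eq_zero_iff_of_nonneg fun S _ => mul_self_nonneg (f S)).1 h2 S (mem_univ S)
      rw [mul_self_eq_zero] at this
      simp only [hfdef, if_pos hS] at this
      linarith
    obtain ⟨S₀, -, hS₀⟩ := exists_subset_card_eq (s := (univ : Finset Ω)) (n := t + 1)
      (by rw [card_univ]; omega)
    refine ⟨hB, cov 𝓑 S₀, fun S hS => ?_⟩
    have := (h4 S hS).trans (h4 S₀ hS₀).symm
    exact_mod_cast this

/-- Double counting of the pairs of a `t`-set and a block containing it. -/
theorem sum_cov_powersetCard {𝓑 : Finset (Finset Ω)} {w : ℕ} (hB : ∀ B ∈ 𝓑, #B = w) (t : ℕ) :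
    ∑ S ∈ (univ : Finset Ω).powersetCard t, cov 𝓑 S = #𝓑 * w.choose t := by
  simp_rw [cov, Finset.card_filter]
  rw [Finset.sum_comm, ← smul_eq_mul, ← Finset.sum_const]
  refine Finset.sum_congr rfl fun B hBm => ?_
  rw [← Finset.card_filter, ← hB B hBm, ← card_powersetCard]
  congr 1
  ext S
  simp [mem_powersetCard, and_comm]

theorem card_mul_choose {t w l : ℕ} {𝓑 : Finset (Finset Ω)} (hB : ∀ B ∈ 𝓑, #B = w)
    (hl : ∀ S : Finset Ω, #S = t → #{B ∈ 𝓑 | S ⊆ B} = l) :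
    l * (Fintype.card Ω).choose t = #𝓑 * w.choose t := by
  have h : ∀ S ∈ (univ : Finset Ω).powersetCard t, cov 𝓑 S = l :=
    fun S hS => hl S (mem_powersetCard.1 hS).2
  rw [← sum_cov_powersetCard hB, Finset.sum_congr rfl h, sum_const, card_powersetCard,
    card_univ, smul_eq_mul, mul_comm]

/-- The sum over all one-point exchanges of a harmonic function. -/
theorem IsHarmonic.sum_exchange {k : ℕ} {f : Finset Ω → ℝ} (hf : IsHarmonic k f)
    (y : Finset Ω) :
    ∑ i ∈ yᶜ, ∑ j ∈ insert i y, f ((insert i y).erase j) =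
      ((Fintype.card Ω : ℝ) - 2 * #y) * f y := by
  have h1 : ∀ i ∈ yᶜ, ∑ j ∈ insert i y, f ((insert i y).erase j) =
      f y + ∑ j ∈ y, f (insert i (y.erase j)) := by
    intro i hi
    rw [mem_compl] at hi
    rw [sum_insert hi, erase_insert hi]
    congr 1
    refine Finset.sum_congr rfl fun j hj => ?_
    rw [erase_insert_of_ne]
    rintro rfl
    exact hi hj
  have h2 : ∀ j ∈ y, ∑ i ∈ yᶜ, f (insert i (y.erase j)) = - f y := by
    intro j hj
    have h3 := congrFun hf.2 (y.erase j)
    rw [gamma_apply, compl_erase, sum_insert (by simpa using hj), insert_erase hj] at h3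
    simp only [Pi.zero_apply] at h3
    linarith
  rw [Finset.sum_congr rfl h1, Finset.sum_add_distrib, Finset.sum_comm, Finset.sum_congr rfl h2,
    sum_const, sum_const, card_compl, nsmul_eq_mul, nsmul_eq_mul, Nat.cast_sub (card_le_univ y)]
  ring

/-- For a `k`-design which is also a `{k+2}`-design, the covering number of a `k+2`-set is
determined by those of its `k+1`-subsets. -/
theorem IsDesign.cov_add_two {k w : ℕ} {𝓑 : Finset (Finset Ω)} {l : ℕ}
    (hB : ∀ B ∈ 𝓑, #B = w) (hl : ∀ S : Finset Ω, #S = k → #{B ∈ 𝓑 | S ⊆ B} = l)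
    (hkw : k + 1 ≤ w) (hkn : 2 * (k + 1) < Fintype.card Ω)
    (h : ∀ f : Finset Ω → ℝ, IsHarmonic (k + 2) f → ∑ B ∈ 𝓑, extend (k + 2) f B = 0)
    {n L : ℝ} (hn : n = Fintype.card Ω) (hL : (n - k) * L = ((w : ℝ) - k) * l)
    (S : Finset Ω) (hS : #S = k + 2) :
    (n - (k + 1)) * (n - 2 * (k + 1)) * cov 𝓑 S = ((w : ℝ) - (k + 1)) *
      ((n - 2 * (k + 1)) * L + (n - (k + 1)) * (∑ i ∈ S, (cov 𝓑 (S.erase i) : ℝ) - (k + 2) * L)) := by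
  have hn0 : n - k ≠ 0 := by
    rw [hn, sub_ne_zero]; exact_mod_cast (by omega : Fintype.card Ω ≠ k)
  have hn1 : n - (k + 1) ≠ 0 := by
    rw [hn, sub_ne_zero]; exact_mod_cast (by omega : Fintype.card Ω ≠ k + 1)
  have hn2 : n - 2 * (k + 1) ≠ 0 := by
    rw [hn, sub_ne_zero]; exact_mod_cast (by omega : Fintype.card Ω ≠ 2 * (k + 1))
  have hn3 : n - (k + 1) * 2 ≠ 0 := by rwa [mul_comm]
  set ε : Finset Ω → ℝ := fun S => if #S = k + 1 then (cov 𝓑 S : ℝ) - L else 0 with hε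
  have hεh : IsHarmonic (k + 1) ε := by
    have := IsDesign.isHarmonic_cov (k := k) hB (by omega) (by omega) (l := (l : ℝ))
      fun S hS => by exact_mod_cast hl S hS
    have hL' : ((w : ℝ) - k) / ((Fintype.card Ω : ℝ) - k) * l = L := by
      rw [← hn, div_mul_eq_mul_div, ← hL]; field_simp
    rwa [hL'] at this
  set c : ℝ := ((w : ℝ) - (k + 1)) / (n - (k + 1)) * L with hc
  -- Applying γ to the lift of ε multiplies ε by n - 2(k+1), by `IsHarmonic.sum_exchange`; this
  -- value of α therefore makes F harmonic.
  set α : ℝ := ((w : ℝ) - (k + 1)) / (n - 2 * (k + 1)) with hα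
  set F : Finset Ω → ℝ := fun S => if #S = k + 2 then
    (cov 𝓑 S : ℝ) - c - α * ∑ i ∈ S, ε (S.erase i) else 0 with hF
  have hFh : IsHarmonic (k + 2) F := by
    refine isHarmonic_of_gamma (fun z hz => if_neg hz) fun y hy => ?_
    have hcard : ∀ i ∈ yᶜ, #(insert i y) = k + 2 := fun i hi => by
      rw [card_insert_of_notMem (mem_compl.1 hi), hy]
    rw [Finset.sum_congr rfl fun i hi => if_pos (hcard i hi), Finset.sum_sub_distrib,
      Finset.sum_sub_distrib, sum_cov_insert_real hB (by omega), ← Finset.mul_sum yᶜ _ α,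
      hεh.sum_exchange, sum_const, card_compl, hy, nsmul_eq_mul, Nat.cast_sub (by omega), ← hn]
    simp only [hε, hy, if_true, hc, hα]
    push_cast
    field_simp
    ring
  -- F is orthogonal to the covering numbers by hypothesis, and to constants and lifts from
  -- (k+1)-sets by harmonicity. Hence it is orthogonal to itself.
  have h1 := h F hFh
  rw [sum_extend 𝓑 hFh] at h1
  have h2 : ∑ S : Finset Ω, F S * F S = 0 := by
    have h3 : ∀ S : Finset Ω, F S * F S =
        F S * cov 𝓑 S - F S * c - α * (F S * ∑ i ∈ S, ε (S.erase i)) := fun S => by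
      simp only [hF]
      split_ifs <;> ring
    rw [Finset.sum_congr rfl fun S _ => h3 S, Finset.sum_sub_distrib, Finset.sum_sub_distrib, h1,
      ← Finset.sum_mul, hFh.sum_eq_zero (by omega), ← Finset.mul_sum, sum_mul_sum_erase, hFh.2]
    simp
  have h4 := (Finset.sum_eq_zero_iff_of_nonneg fun S _ => mul_self_nonneg (F S)).1 h2 S (mem_univ S)
  rw [mul_self_eq_zero] at h4
  simp only [hF, if_pos hS] at h4
  have h5 : ∑ i ∈ S, ε (S.erase i) = ∑ i ∈ S, (cov 𝓑 (S.erase i) : ℝ) - (k + 2) * L := by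
    have : ∀ i ∈ S, ε (S.erase i) = (cov 𝓑 (S.erase i) : ℝ) - L := fun i hi => by
      simp only [hε]
      rw [if_pos (by rw [card_erase_of_mem hi]; omega)]
    rw [Finset.sum_congr rfl this, Finset.sum_sub_distrib, sum_const, hS, nsmul_eq_mul]
    push_cast
    ring
  rw [h5] at h4
  have h6 : (cov 𝓑 S : ℝ) = c + α * (∑ i ∈ S, (cov 𝓑 (S.erase i) : ℝ) - (k + 2) * L) := by
    linarith
  rw [h6, hc, hα]
  field_simp

end Designs

end SupportDesign

namespace SupportDesign

/-! ### The MacWilliams identity for harmonic weight enumerators -/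

section MacWilliams

variable {n : ℕ}

/-- The nontrivial additive character of `𝔽₂`, with real values. -/
noncomputable def sgn (a : ZMod 2) : ℝ := if a = 0 then 1 else -1

theorem sgn_zero : sgn 0 = 1 := if_pos rfl

theorem sgn_one : sgn 1 = -1 := if_neg one_ne_zero

theorem zmod_two_eq_one {a : ZMod 2} (h : a ≠ 0) : a = 1 := by
  revert a; decide

theorem sgn_add (a b : ZMod 2) : sgn (a + b) = sgn a * sgn b := by
  by_cases ha : a = 0
  · rw [ha, zero_add, sgn_zero, one_mul]
  by_cases hb : b = 0
  · rw [hb, add_zero, sgn_zero, mul_one]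
  rw [zmod_two_eq_one ha, zmod_two_eq_one hb, show (1 : ZMod 2) + 1 = 0 by decide, sgn_zero,
    sgn_one]
  norm_num

theorem sgn_sum {ι : Type*} (s : Finset ι) (g : ι → ZMod 2) :
    sgn (∑ i ∈ s, g i) = ∏ i ∈ s, sgn (g i) := by
  classical
  induction s using Finset.induction_on with
  | empty => simp [sgn_zero]
  | insert i s hi ih => rw [sum_insert hi, prod_insert hi, sgn_add, ih]

theorem card_supp (c : Fin n → ZMod 2) : #(supp c) = hammingNorm c := rfl

theorem mem_supp {c : Fin n → ZMod 2} {i : Fin n} : i ∈ supp c ↔ c i ≠ 0 := by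
  simp [supp]

theorem supp_injective : Function.Injective (supp (n := n)) := by
  intro c d h
  funext i
  have hi : c i ≠ 0 ↔ d i ≠ 0 := by rw [← mem_supp, ← mem_supp, h]
  by_cases hc : c i = 0
  · rw [hc, not_not.1 (mt hi.2 (not_not.2 hc))]
  · rw [zmod_two_eq_one hc, zmod_two_eq_one (hi.1 hc)]

open Classical in
/-- The finite set of the words of a code. -/
noncomputable def words (C : Submodule (ZMod 2) (Fin n → ZMod 2)) : Finset (Fin n → ZMod 2) := {c | c ∈ C}

theorem mem_words {C : Submodule (ZMod 2) (Fin n → ZMod 2)} {c : Fin n → ZMod 2} :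
    c ∈ words C ↔ c ∈ C := by
  simp [words]

theorem sum_sgn_dotProduct_of_mem {C : Submodule (ZMod 2) (Fin n → ZMod 2)} (hC : IsSelfDual C)
    {u : Fin n → ZMod 2} (hu : u ∈ C) : ∑ c ∈ words C, sgn (u ⬝ᵥ c) = #(words C) := by
  rw [Finset.sum_congr rfl fun c hc => by rw [(hC u).1 hu c (mem_words.1 hc), sgn_zero]]
  simp

/-- Translation by a codeword d with u · d ≠ 0 permutes the code and flips every sign. -/
theorem sum_sgn_dotProduct_of_notMem {C : Submodule (ZMod 2) (Fin n → ZMod 2)}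
    (hC : IsSelfDual C) {u : Fin n → ZMod 2} (hu : u ∉ C) :
    ∑ c ∈ words C, sgn (u ⬝ᵥ c) = 0 := by
  obtain ⟨d, hd, hud⟩ : ∃ d ∈ C, u ⬝ᵥ d ≠ 0 := by
    by_contra! h
    exact hu ((hC u).2 h)
  have h : ∑ c ∈ words C, sgn (u ⬝ᵥ c) = ∑ c ∈ words C, -sgn (u ⬝ᵥ c) := by
    refine Finset.sum_bij' (fun c _ => c + d) (fun c _ => c - d) ?_ ?_ ?_ ?_ ?_
    · exact fun c hc => mem_words.2 (C.add_mem (mem_words.1 hc) hd)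
    · exact fun c hc => mem_words.2 (C.sub_mem (mem_words.1 hc) hd)
    · exact fun c _ => add_sub_cancel_right c d
    · exact fun c _ => sub_add_cancel c d
    · intro c _
      rw [dotProduct_add, sgn_add, zmod_two_eq_one hud, sgn_one]
      ring
  rw [Finset.sum_neg_distrib] at h
  linarith

theorem poisson {C : Submodule (ZMod 2) (Fin n → ZMod 2)} (hC : IsSelfDual C)
    (g : (Fin n → ZMod 2) → ℝ) :
    ∑ v ∈ words C, ∑ u, sgn (u ⬝ᵥ v) * g u = #(words C) * ∑ u ∈ words C, g u := by
  rw [Finset.sum_comm, Finset.mul_sum, ← Finset.sum_subset (subset_univ (words C))]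
  · refine Finset.sum_congr rfl fun u hu => ?_
    rw [← Finset.sum_mul, sum_sgn_dotProduct_of_mem hC (mem_words.1 hu)]
  · intro u _ hu
    rw [← Finset.sum_mul, sum_sgn_dotProduct_of_notMem hC (mt mem_words.2 hu), zero_mul]

theorem pow_hammingNorm (t : ℝ) (u : Fin n → ZMod 2) :
    t ^ hammingNorm u = ∏ i, if u i = 0 then 1 else t := by
  rw [Finset.prod_ite, prod_const_one, one_mul, prod_const]
  rfl

theorem sum_pi_prod (g : Fin n → ZMod 2 → ℝ) :
    ∑ u : Fin n → ZMod 2, ∏ i, g i (u i) = ∏ i, (g i 0 + g i 1) := by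
  have h : ∀ i, g i 0 + g i 1 = ∑ a : ZMod 2, g i a := fun i => (Fin.sum_univ_two (g i)).symm
  simp_rw [h]
  rw [Finset.prod_univ_sum, Fintype.piFinset_univ]

/-- The Fourier transform of a harmonic function weighted by `t ^ weight`. -/
theorem IsHarmonic.fourier {k : ℕ} {f : Finset (Fin n) → ℝ} (hf : IsHarmonic k f) {t : ℝ}
    (h1 : 1 + t ≠ 0) (h2 : 1 - t ≠ 0) (v : Fin n → ZMod 2) :
    ∑ u : Fin n → ZMod 2, sgn (u ⬝ᵥ v) * (extend k f (supp u) * t ^ hammingNorm u) =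
      (-(2 * t) / ((1 - t) * (1 + t))) ^ k * (1 + t) ^ n *
        (extend k f (supp v) * ((1 - t) / (1 + t)) ^ hammingNorm v) := by
  -- A coordinate outside z contributes 1 ± t, one inside z contributes ± t; p and q are the
  -- quotients at the coordinates where v is nonzero and zero.
  set p : ℝ := -t / (1 - t) with hp
  set q : ℝ := t / (1 + t) with hq
  have hpq : -(2 * t) / ((1 - t) * (1 + t)) = p - q := by
    rw [hp, hq]; field_simp; ring
  have hL : ∀ u : Fin n → ZMod 2, sgn (u ⬝ᵥ v) * (extend k f (supp u) * t ^ hammingNorm u) =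
      ∑ z : Finset (Fin n), f z * ∏ i, (sgn (u i * v i) * (if u i = 0 then 1 else t) *
        (if i ∈ z then (if u i = 0 then 0 else 1) else 1)) := by
    intro u
    rw [hf.extend_eq_multilin, multilin, dotProduct, sgn_sum, pow_hammingNorm, Finset.sum_mul,
      Finset.mul_sum]
    refine Finset.sum_congr rfl fun z _ => ?_
    rw [Finset.prod_mul_distrib, Finset.prod_mul_distrib, Finset.prod_ite_mem, univ_inter]
    simp only [mem_supp, ne_eq, ite_not]
    ring
  have hz : ∀ z : Finset (Fin n), ∑ u : Fin n → ZMod 2, f z * ∏ i, (sgn (u i * v i) *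
      (if u i = 0 then 1 else t) * (if i ∈ z then (if u i = 0 then 0 else 1) else 1)) =
      (1 + t) ^ n * ((1 - t) / (1 + t)) ^ hammingNorm v *
        (f z * ∏ i ∈ z, if i ∈ supp v then p else q) := by
    intro z
    rw [← Finset.mul_sum, sum_pi_prod fun i a => sgn (a * v i) * (if a = 0 then 1 else t) *
      (if i ∈ z then (if a = 0 then 0 else 1) else 1), pow_hammingNorm, mul_left_comm]
    congr 1
    have hn : (1 + t) ^ n = ∏ _i : Fin n, (1 + t) := by simp
    have hz' : ∏ i ∈ z, (if i ∈ supp v then p else q) =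
        ∏ i, if i ∈ z then (if i ∈ supp v then p else q) else 1 := by
      rw [Finset.prod_ite_mem, univ_inter]
    rw [hn, hz', ← Finset.prod_mul_distrib, ← Finset.prod_mul_distrib]
    refine Finset.prod_congr rfl fun i _ => ?_
    simp only [mem_supp, zero_mul, one_mul, sgn_zero, one_ne_zero, if_true, if_false, ne_eq,
      ite_not]
    by_cases hi : i ∈ z <;> by_cases hv : v i = 0
    · simp only [hi, hv, if_true, sgn_zero, hq]
      field_simp
      ring
    · rw [zmod_two_eq_one hv]
      simp only [hi, if_true, sgn_one, hp, one_ne_zero, if_false]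
      field_simp
      ring
    · simp [hi, hv, sgn_zero]
    · rw [zmod_two_eq_one hv]
      simp only [hi, sgn_one, one_ne_zero, if_false]
      field_simp
      ring
  rw [Finset.sum_congr rfl fun u _ => hL u, Finset.sum_comm, hpq,
    Finset.sum_congr rfl fun z _ => hz z, ← Finset.mul_sum, ← multilin, hf.multilin_two_valued]
  ring

/-- The harmonic weight enumerator, dehomogenized. -/
noncomputable def weightEnum (C : Submodule (ZMod 2) (Fin n → ZMod 2)) (k : ℕ)
    (f : Finset (Fin n) → ℝ) (t : ℝ) : ℝ :=
  ∑ u ∈ words C, extend k f (supp u) * t ^ hammingNorm u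

theorem macWilliams {C : Submodule (ZMod 2) (Fin n → ZMod 2)} (hC : IsSelfDual C) {k : ℕ}
    {f : Finset (Fin n) → ℝ} (hf : IsHarmonic k f) {t : ℝ} (h1 : 1 + t ≠ 0) (h2 : 1 - t ≠ 0) :
    #(words C) * weightEnum C k f t = (-(2 * t) / ((1 - t) * (1 + t))) ^ k * (1 + t) ^ n *
      weightEnum C k f ((1 - t) / (1 + t)) := by
  rw [weightEnum, ← poisson hC, Finset.sum_congr rfl fun v _ => hf.fourier h1 h2 v,
    ← Finset.mul_sum, weightEnum]

/-- The points 1/3 and 1/2 are exchanged by t ↦ (1 - t)/(1 + t), so the identity of degree 0 can be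
applied twice and the positive enumerator cancelled. -/
theorem card_words_sq {C : Submodule (ZMod 2) (Fin n → ZMod 2)} (hC : IsSelfDual C) :
    (#(words C) : ℝ) ^ 2 = 2 ^ n := by
  have h1 := macWilliams hC (isHarmonic_zero_single (Ω := Fin n)) (t := 1 / 3) (by norm_num)
    (by norm_num)
  have h2 := macWilliams hC (isHarmonic_zero_single (Ω := Fin n)) (t := 1 / 2) (by norm_num)
    (by norm_num)
  have hpos : 0 < weightEnum C 0 (fun z : Finset (Fin n) => if z = ∅ then (1 : ℝ) else 0) (1 / 3) := by
    unfold weightEnum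
    simp_rw [extend_zero_single]
    exact Finset.sum_pos (fun u _ => by positivity) ⟨0, mem_words.2 C.zero_mem⟩
  rw [show (1 - 1 / 3) / (1 + 1 / 3) = (1 / 2 : ℝ) by norm_num] at h1
  rw [show (1 - 1 / 2) / (1 + 1 / 2) = (1 / 3 : ℝ) by norm_num] at h2
  have h3 : (2 : ℝ) ^ n = (1 + 1 / 3) ^ n * (1 + 1 / 2) ^ n := by
    rw [← mul_pow]; norm_num
  refine mul_right_cancel₀ hpos.ne' ?_
  rw [h3]
  linear_combination (#(words C) : ℝ) * h1 + (1 + 1 / 3) ^ n * h2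

theorem sum_supportDesign (C : Submodule (ZMod 2) (Fin n → ZMod 2)) (w : ℕ)
    (F : Finset (Fin n) → ℝ) :
    ∑ B ∈ supportDesign C w, F B = ∑ u ∈ words C with hammingNorm u = w, F (supp u) := by
  symm
  refine Finset.sum_bij (fun u _ => supp u) ?_ (fun u _ v _ h => supp_injective h) ?_
    fun _ _ => rfl
  · intro u hu
    rw [mem_filter, mem_words] at hu
    simp only [supportDesign, mem_filter, mem_univ, true_and]
    exact ⟨u, hu.1, hu.2, rfl⟩
  · intro B hB
    simp only [supportDesign, mem_filter, mem_univ, true_and] at hB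
    obtain ⟨u, hu, hw, rfl⟩ := hB
    exact ⟨u, mem_filter.2 ⟨mem_words.2 hu, hw⟩, rfl⟩

theorem card_of_mem_supportDesign {C : Submodule (ZMod 2) (Fin n → ZMod 2)} {w : ℕ} :
    ∀ B ∈ supportDesign C w, #B = w := by
  intro B hB
  simp only [supportDesign, mem_filter, mem_univ, true_and] at hB
  obtain ⟨u, -, hw, rfl⟩ := hB
  exact hw

theorem one_mem {C : Submodule (ZMod 2) (Fin n → ZMod 2)} (hC : IsSelfDual C)
    (hC' : IsDoublyEven C) : (1 : Fin n → ZMod 2) ∈ C := by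
  refine (hC 1).2 fun y hy => ?_
  have h : (1 : Fin n → ZMod 2) ⬝ᵥ y = (hammingNorm y : ZMod 2) := by
    rw [one_dotProduct, ← card_supp, supp, Finset.card_filter, Nat.cast_sum]
    refine Finset.sum_congr rfl fun i _ => ?_
    by_cases hi : y i = 0
    · simp [hi]
    · simp [zmod_two_eq_one hi]
  rw [h, ZMod.natCast_eq_zero_iff]
  exact (by norm_num : 2 ∣ 4).trans (hC' y hy)

theorem hammingNorm_add_one (c : Fin n → ZMod 2) : hammingNorm (c + 1) + hammingNorm c = n := by
  have h : supp (c + 1) = (supp c)ᶜ := by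
    ext i
    rw [mem_compl, mem_supp, mem_supp, Pi.add_apply, Pi.one_apply, not_not]
    by_cases hi : c i = 0
    · simp [hi]
    · rw [zmod_two_eq_one hi]
      decide
  rw [← card_supp, ← card_supp, h, card_compl, Fintype.card_fin]
  have := card_le_univ (supp c)
  rw [Fintype.card_fin] at this
  omega

end MacWilliams

/-! ### Weights of extremal codes -/

section Extremal

variable {m : ℕ} {C : Submodule (ZMod 2) (Fin (24 * m + 8) → ZMod 2)}

theorem IsExtremalTypeII.le_hammingNorm (hC : IsExtremalTypeII C) {c : Fin (24 * m + 8) → ZMod 2}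
    (hc : c ∈ C) (h0 : c ≠ 0) : 4 * m + 4 ≤ hammingNorm c := by
  have := hC.minWeight.2 ⟨c, hc, h0, rfl⟩
  omega

/-- The all-one word lies in the code, so the minimum weight bound applied to the complement of c
bounds the weight of c from above. -/
theorem IsExtremalTypeII.exists_hammingNorm_eq (hC : IsExtremalTypeII C)
    {c : Fin (24 * m + 8) → ZMod 2} (hc : c ∈ C) (h0 : c ≠ 0) (h1 : c ≠ 1) :
    ∃ j ≤ 4 * m, hammingNorm c = 4 * m + 4 + 4 * j := by
  have h2 := hC.le_hammingNorm hc h0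
  have h3 := hC.le_hammingNorm (C.add_mem hc (one_mem hC.selfDual hC.doublyEven)) (by
    intro h
    refine h1 ?_
    funext i
    have := congrFun h i
    simp only [Pi.add_apply, Pi.one_apply, Pi.zero_apply] at this ⊢
    rwa [← CharTwo.sub_eq_add, sub_eq_zero] at this)
  have h4 := hammingNorm_add_one c
  obtain ⟨r, hr⟩ := hC.doublyEven c hc
  exact ⟨r - m - 1, by omega, by omega⟩

theorem IsExtremalTypeII.card_words (hC : IsExtremalTypeII C) :
    (#(words C) : ℝ) = 2 ^ (12 * m + 4) := by
  have h := card_words_sq hC.selfDual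
  have h2 : (2 : ℝ) ^ (24 * m + 8) = (2 ^ (12 * m + 4)) ^ 2 := by
    rw [← pow_mul]; congr 1; ring
  rw [h2] at h
  exact (pow_left_inj₀ (by positivity) (by positivity) two_ne_zero).1 h

/-- The sum of the extension of `f` over the blocks of the support design of weight
`4m + 4 + 4j`. -/
noncomputable def blockSum (C : Submodule (ZMod 2) (Fin (24 * m + 8) → ZMod 2)) (k : ℕ)
    (f : Finset (Fin (24 * m + 8)) → ℝ) (j : ℕ) : ℝ :=
  ∑ B ∈ supportDesign C (4 * m + 4 + 4 * j), extend k f B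

/-- The only words with weight outside the range are 0 and the all-one word, and f̃ vanishes on ∅
and on the whole set. -/
theorem IsExtremalTypeII.weightEnum_eq (hC : IsExtremalTypeII C) {k : ℕ} (hk : k ≠ 0)
    {f : Finset (Fin (24 * m + 8)) → ℝ} (hf : IsHarmonic k f) (t : ℝ) :
    weightEnum C k f t = t ^ (4 * m + 4) *
      ∑ j ∈ range (4 * m + 1), blockSum C k f j * (t ^ 4) ^ j := by
  classical
  obtain ⟨P, hP⟩ : ∃ P : (Fin (24 * m + 8) → ZMod 2) → Prop,
      ∀ u, P u ↔ ∃ j ∈ range (4 * m + 1), hammingNorm u = 4 * m + 4 + 4 * j := ⟨_, fun _ => Iff.rfl⟩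
  have h0 : ∀ u ∈ words C, ¬ P u → extend k f (supp u) = 0 := by
    intro u hu h
    rw [hP] at h
    by_cases h0 : u = 0
    · rw [h0, show supp (0 : Fin (24 * m + 8) → ZMod 2) = ∅ by simp [supp], extend_empty hk]
    by_cases h1 : u = 1
    · rw [h1, show supp (1 : Fin (24 * m + 8) → ZMod 2) = univ by simp [supp], hf.extend_univ hk]
    obtain ⟨j, hj, hw⟩ := hC.exists_hammingNorm_eq (mem_words.1 hu) h0 h1
    exact absurd ⟨j, mem_range.2 (by omega), hw⟩ h
  rw [weightEnum, Finset.mul_sum]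
  simp_rw [blockSum, sum_supportDesign, Finset.sum_mul, Finset.mul_sum]
  rw [← Finset.sum_filter_add_sum_filter_not (words C) P,
    Finset.sum_eq_zero (s := {u ∈ words C | ¬ P u}) fun u hu => by
      rw [mem_filter] at hu
      rw [h0 u hu.1 hu.2, zero_mul], add_zero, Finset.sum_sigma']
  refine Finset.sum_bij' (fun u _ => ⟨(hammingNorm u - (4 * m + 4)) / 4, u⟩) (fun p _ => p.2)
    ?_ ?_ ?_ ?_ ?_
  · intro u hu
    rw [mem_filter, hP] at hu
    obtain ⟨hu, j, hj, hw⟩ := hu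
    simp only [mem_sigma, mem_filter, hu, true_and]
    rw [mem_range] at hj ⊢
    omega
  · rintro ⟨j, u⟩ h
    simp only [mem_sigma, mem_filter] at h ⊢
    exact ⟨h.2.1, (hP u).2 ⟨j, h.1, h.2.2⟩⟩
  · intro u hu; rfl
  · rintro ⟨j, u⟩ h
    simp only [mem_sigma, mem_filter] at h
    rw [h.2.2]
    congr 1
    omega
  · intro u hu
    rw [mem_filter, hP] at hu
    obtain ⟨hu, j, hj, hw⟩ := hu
    rw [hw, show (4 * m + 4 + 4 * j - (4 * m + 4)) / 4 = j by omega]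
    ring

end Extremal

end SupportDesign

namespace SupportDesign

/-! ### Invariant polynomials and divisibility by powers of 1 - X -/

section Invariants

open Polynomial

/-- `p` has degree at most `d`, and the form of degree `4d` with dehomogenization `p (t ^ 4)` is
multiplied by `c` under `(x, y) ↦ (x + y, x - y)`. -/
def IsSigmaInv (d : ℕ) (c : ℝ) (p : ℝ[X]) : Prop :=
  p.natDegree ≤ d ∧ ∀ t : ℝ, t ≠ 0 → t ≠ 1 → t ≠ -1 →
    (1 + t) ^ (4 * d) * p.eval (((1 - t) / (1 + t)) ^ 4) = c * p.eval (t ^ 4)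

theorem IsSigmaInv.sub {d : ℕ} {c : ℝ} {p q : ℝ[X]} (hp : IsSigmaInv d c p)
    (hq : IsSigmaInv d c q) : IsSigmaInv d c (p - q) := by
  refine ⟨(natDegree_sub_le p q).trans (max_le hp.1 hq.1), fun t h0 h1 h2 => ?_⟩
  rw [eval_sub, eval_sub, mul_sub, mul_sub, hp.2 t h0 h1 h2, hq.2 t h0 h1 h2]

theorem IsSigmaInv.const_mul {d : ℕ} {c : ℝ} {p : ℝ[X]} (hp : IsSigmaInv d c p) (a : ℝ) :
    IsSigmaInv d c (C a * p) := by
  refine ⟨(natDegree_C_mul_le a p).trans hp.1, fun t h0 h1 h2 => ?_⟩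
  rw [eval_C_mul, eval_C_mul, mul_left_comm, hp.2 t h0 h1 h2, mul_left_comm]

theorem IsSigmaInv.pow {d : ℕ} {c : ℝ} {p : ℝ[X]} (hp : IsSigmaInv d c p) (N : ℕ) :
    IsSigmaInv (N * d) (c ^ N) (p ^ N) := by
  refine ⟨natDegree_pow_le.trans (Nat.mul_le_mul_left N hp.1), fun t h0 h1 h2 => ?_⟩
  rw [eval_pow, eval_pow, ← mul_pow, ← hp.2 t h0 h1 h2, mul_pow, ← pow_mul]
  congr 2
  ring

/-- Since p depends on t^4 only, t and -t give the same right-hand side. With t = (1 - s)/(1 + s)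
the two left-hand sides compare p at s^4 and at s^(-4). -/
theorem IsSigmaInv.reflect_eq {d : ℕ} {c : ℝ} {p : ℝ[X]} (hp : IsSigmaInv d c p) :
    p.reflect d = p := by
  refine eq_of_infinite_eval_eq _ _ ((Set.Ioo_infinite (zero_lt_one' ℝ)).mono ?_)
  intro y hy
  obtain ⟨s, hs0, hs1, rfl⟩ : ∃ s : ℝ, 0 < s ∧ s < 1 ∧ s ^ 4 = y := by
    refine ⟨√(√y), by have := hy.1; positivity, ?_, ?_⟩
    · rw [Real.sqrt_lt' one_pos, one_pow, Real.sqrt_lt' one_pos, one_pow]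
      exact hy.2
    · rw [show 4 = 2 * 2 by norm_num, pow_mul, Real.sq_sqrt (Real.sqrt_nonneg _),
        Real.sq_sqrt hy.1.le]
  have hs : (1 + s) ≠ 0 := by positivity
  have h1 := hp.2 ((1 - s) / (1 + s)) (div_ne_zero (by linarith) hs)
    (by rw [Ne, div_eq_one_iff_eq hs]; intro h; linarith)
    (by rw [Ne, div_eq_iff hs]; intro h; linarith)
  have h2 := hp.2 (-((1 - s) / (1 + s))) (neg_ne_zero.2 (div_ne_zero (by linarith) hs))
    (by rw [Ne, neg_eq_iff_eq_neg, div_eq_iff hs]; intro h; linarith)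
    (by rw [Ne, neg_inj, div_eq_one_iff_eq hs]; intro h; linarith)
  rw [show 1 + (1 - s) / (1 + s) = 2 / (1 + s) by field_simp; ring,
    show 1 - (1 - s) / (1 + s) = 2 * s / (1 + s) by field_simp; ring] at h1
  rw [show 1 + -((1 - s) / (1 + s)) = 2 * s / (1 + s) by field_simp; ring,
    show 1 - -((1 - s) / (1 + s)) = 2 / (1 + s) by field_simp; ring, neg_pow,
    show (-1 : ℝ) ^ 4 = 1 by norm_num, one_mul, ← h1] at h2
  rw [show 2 * s / (1 + s) / (2 / (1 + s)) = s by field_simp,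
    show 2 / (1 + s) / (2 * s / (1 + s)) = s⁻¹ by field_simp,
    show 2 * s / (1 + s) = 2 / (1 + s) * s by ring, mul_pow, mul_assoc] at h2
  have h3 := mul_left_cancel₀ (pow_ne_zero _ (div_ne_zero two_ne_zero hs)) h2
  have hs4 : s ^ 4 ≠ 0 := pow_ne_zero 4 hs0.ne'
  let _ : Invertible (s ^ 4)⁻¹ := invertibleOfNonzero (inv_ne_zero hs4)
  have h4 := eval₂_reflect_mul_pow (RingHom.id ℝ) (s ^ 4)⁻¹ d p hp.1
  rw [invOf_eq_inv, inv_inv, eval₂_id, eval₂_id, ← inv_pow, ← pow_mul] at h4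
  rw [Set.mem_ofPred_eq, ← h3, ← h4, mul_left_comm, ← mul_pow, mul_inv_cancel₀ hs0.ne', one_pow,
    mul_one]

theorem IsSigmaInv.coeff_eq {d : ℕ} {c : ℝ} {p : ℝ[X]} (hp : IsSigmaInv d c p) :
    p.coeff d = p.coeff 0 := by
  conv_rhs => rw [← hp.reflect_eq]
  rw [coeff_reflect, revAt_le (Nat.zero_le d), Nat.sub_zero]

theorem isCoprime_one_sub_X_pow_X_pow (e : ℕ) : IsCoprime ((1 - X : ℝ[X]) ^ e) (X ^ e) :=
  IsCoprime.pow ⟨1, 1, by ring⟩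

/-- The factor 1 - X divides 1 - X^4 exactly once, and the cofactor 1 + X + X^2 + X^3 is coprime to
it. -/
theorem one_sub_X_pow_dvd_of_expand (e : ℕ) {p : ℝ[X]} (h : (1 - X) ^ e ∣ expand ℝ 4 p) :
    (1 - X) ^ e ∣ p := by
  induction e generalizing p with
  | zero => simp
  | succ e ih =>
    have h1 : p.eval 1 = 0 := by
      obtain ⟨q, hq⟩ := h
      have := congrArg (eval 1) hq
      rw [expand_eval] at this
      simpa using this
    obtain ⟨q, rfl⟩ := dvd_iff_isRoot.2 h1
    have h2 : expand ℝ 4 ((X - C 1) * q) = (1 - X) * ((-(1 + X + X ^ 2 + X ^ 3)) * expand ℝ 4 q) := by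
      rw [map_mul, map_sub, expand_X, expand_C, C_1]
      ring
    rw [h2, pow_succ', mul_dvd_mul_iff_left (by
      intro h; have := congrArg (eval 0) h; simp at this)] at h
    have h3 : IsCoprime ((1 - X : ℝ[X]) ^ e) (-(1 + X + X ^ 2 + X ^ 3)) := by
      refine IsCoprime.pow_left ⟨C (1 / 4) * (X ^ 2 + 2 * X + 3), -C (1 / 4), ?_⟩
      have : C (1 / 4 : ℝ) * 4 = 1 := by
        rw [show (4 : ℝ[X]) = C 4 from rfl, ← C_mul]; norm_num
      linear_combination this
    rw [C_1, pow_succ', show (X - 1) * q = (1 - X) * (-q) by ring]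
    refine mul_dvd_mul_left _ ((dvd_neg).2 (ih (h3.dvd_of_dvd_mul_left h)))

/-- The substitution carries the zero of order e at t = 0 to one at t = 1. After clearing
denominators, (1 - X)^e divides X^e p(X^4), hence p(X^4), hence p. -/
theorem one_sub_X_pow_dvd {d e : ℕ} {c : ℝ} {p : ℝ[X]} (hp : p.natDegree ≤ d) (hc : c ≠ 0)
    (h : ∀ t : ℝ, t ≠ 0 → t ≠ 1 → t ≠ -1 → (1 + t) ^ (4 * d + 2 * e) *
      (((1 - t) / (1 + t)) ^ e * p.eval (((1 - t) / (1 + t)) ^ 4)) = c * (t ^ e * p.eval (t ^ 4))) :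
    (1 - X) ^ e ∣ p := by
  set Q : ℝ[X] := ∑ j ∈ range (d + 1), C (p.coeff j) * (1 + X) ^ (4 * (d - j)) * (1 - X) ^ (4 * j)
    with hQ
  have hid : (1 - X) ^ e * ((1 + X) ^ e * Q) = C c * X ^ e * expand ℝ 4 p := by
    refine eq_of_infinite_eval_eq _ _ ((Set.Ioo_infinite (zero_lt_one' ℝ)).mono ?_)
    intro t ht
    have ht1 : 1 + t ≠ 0 := by have := ht.1; positivity
    have h1 := h t ht.1.ne' ht.2.ne (by have := ht.1; intro h; linarith)
    have hQt : Q.eval t = (1 + t) ^ (4 * d) * p.eval (((1 - t) / (1 + t)) ^ 4) := by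
      rw [hQ, eval_finsetSum, eval_eq_sum_range' (Nat.lt_succ_of_le hp), Finset.mul_sum]
      refine Finset.sum_congr rfl fun j hj => ?_
      have hj' : j ≤ d := Nat.lt_succ_iff.1 (mem_range.1 hj)
      rw [show 4 * d = 4 * (d - j) + 4 * j by omega, pow_add, ← pow_mul, div_pow]
      simp only [eval_mul, eval_C, eval_pow, eval_add, eval_one, eval_X, eval_sub]
      field_simp
    simp only [Set.mem_ofPred_eq, eval_mul, eval_pow, eval_sub, eval_add, eval_one, eval_X, hQt,
      eval_C, expand_eval]
    have hs : ((1 - t) / (1 + t)) ^ e * (1 + t) ^ e = (1 - t) ^ e := by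
      rw [← mul_pow, div_mul_cancel₀ _ ht1]
    rw [mul_assoc c, ← h1, ← hs]
    ring
  refine one_sub_X_pow_dvd_of_expand e ?_
  refine (isCoprime_one_sub_X_pow_X_pow e).dvd_of_dvd_mul_left (?_ : _ ∣ X ^ e * expand ℝ 4 p)
  rw [← (isUnit_C.2 hc.isUnit).dvd_mul_left, ← mul_assoc, ← hid]
  exact dvd_mul_right _ _

theorem natDegree_one_sub_X_pow_mul (e : ℕ) {q : ℝ[X]} (hq : q ≠ 0) :
    ((1 - X) ^ e * q).natDegree = e + q.natDegree := by
  have h1 : (1 - X : ℝ[X]) = -(X - C 1) := by rw [C_1]; ring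
  have h2 : (1 - X : ℝ[X]).natDegree = 1 := by rw [h1, natDegree_neg, natDegree_X_sub_C]
  have h3 : (1 - X : ℝ[X]) ≠ 0 := by
    intro h; rw [h] at h2; simp at h2
  rw [natDegree_mul (pow_ne_zero e h3) hq, natDegree_pow, h2, mul_one]

theorem eq_zero_of_natDegree_lt {d e : ℕ} {c : ℝ} {p : ℝ[X]} (hp : p.natDegree ≤ d) (hde : d < e)
    (hc : c ≠ 0)
    (h : ∀ t : ℝ, t ≠ 0 → t ≠ 1 → t ≠ -1 → (1 + t) ^ (4 * d + 2 * e) *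
      (((1 - t) / (1 + t)) ^ e * p.eval (((1 - t) / (1 + t)) ^ 4)) = c * (t ^ e * p.eval (t ^ 4))) :
    p = 0 := by
  obtain ⟨q, rfl⟩ := one_sub_X_pow_dvd hp hc h
  by_contra h0
  rw [natDegree_one_sub_X_pow_mul e (right_ne_zero_of_mul h0)] at hp
  omega

/-- The removed factor is the e-th power of t(1 - t^4), which dehomogenizes xy(x^4 - y^4); that form
of degree 6 is multiplied by 8 under the substitution. -/
theorem exists_isSigmaInv_quotient {d e : ℕ} {c : ℝ} {p : ℝ[X]} (hp : p.natDegree ≤ d + e)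
    (hc : c ≠ 0)
    (h : ∀ t : ℝ, t ≠ 0 → t ≠ 1 → t ≠ -1 → (1 + t) ^ (4 * (d + e) + 2 * e) *
      (((1 - t) / (1 + t)) ^ e * p.eval (((1 - t) / (1 + t)) ^ 4)) = c * (t ^ e * p.eval (t ^ 4))) :
    ∃ q : ℝ[X], p = (1 - X) ^ e * q ∧ IsSigmaInv d (c / 8 ^ e) q := by
  obtain ⟨q, rfl⟩ := one_sub_X_pow_dvd hp hc h
  refine ⟨q, rfl, ?_, fun t h0 h1 h2 => ?_⟩
  · by_cases hq : q = 0
    · simp [hq]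
    rw [natDegree_one_sub_X_pow_mul e hq] at hp
    omega
  · have ht : 1 + t ≠ 0 := fun h => h2 (by linarith)
    have ht' : t * (1 - t ^ 4) ≠ 0 := by
      refine mul_ne_zero h0 ?_
      rw [show 1 - t ^ 4 = (1 - t) * (1 + t) * (1 + t ^ 2) by ring]
      exact mul_ne_zero (mul_ne_zero (sub_ne_zero.2 h1.symm) ht) (by positivity)
    have h3 := h t h0 h1 h2
    simp only [eval_mul, eval_pow, eval_sub, eval_one, eval_X] at h3
    have h4 : (1 + t) ^ 6 * ((1 - t) / (1 + t)) * (1 - ((1 - t) / (1 + t)) ^ 4) =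
        8 * (t * (1 - t ^ 4)) := by
      field_simp
      ring
    have h5 : (1 + t) ^ (4 * (d + e) + 2 * e) * (((1 - t) / (1 + t)) ^ e *
        ((1 - ((1 - t) / (1 + t)) ^ 4) ^ e * q.eval (((1 - t) / (1 + t)) ^ 4))) =
        (t * (1 - t ^ 4)) ^ e * (8 ^ e * ((1 + t) ^ (4 * d) * q.eval (((1 - t) / (1 + t)) ^ 4))) := by
      have := congrArg (fun x => x ^ e) h4
      simp only [mul_pow] at this
      rw [show 4 * (d + e) + 2 * e = 4 * d + 6 * e by ring, pow_add, pow_mul _ 6 e, mul_pow]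
      linear_combination (1 + t) ^ (4 * d) * q.eval (((1 - t) / (1 + t)) ^ 4) * this
    rw [h5, show c * (t ^ e * ((1 - t ^ 4) ^ e * q.eval (t ^ 4))) =
      (t * (1 - t ^ 4)) ^ e * (c * q.eval (t ^ 4)) by rw [mul_pow]; ring] at h3
    have h6 := mul_left_cancel₀ (pow_ne_zero e ht') h3
    rw [div_mul_eq_mul_div, ← h6]
    field_simp

theorem IsSigmaInv.eq_C {c : ℝ} {p : ℝ[X]} (hp : IsSigmaInv 0 c p) : p = C (p.coeff 0) :=
  eq_C_of_natDegree_le_zero hp.1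

/-- Here and in the next degrees, evaluating the functional equation at a few rational points gives
enough linear equations to determine the coefficients. -/
theorem IsSigmaInv.degree_one {p : ℝ[X]} (hp : IsSigmaInv 1 (-4) p) : p = 0 := by
  have h1 := hp.2 (1 / 2) (by norm_num) (by norm_num) (by norm_num)
  have h2 := hp.2 (1 / 3) (by norm_num) (by norm_num) (by norm_num)
  have h3 := hp.2 2 (by norm_num) (by norm_num) (by norm_num)
  simp only [eval_eq_sum_range' (Nat.lt_succ_of_le hp.1), sum_range_succ, range_zero, sum_empty]
    at h1 h2 h3
  norm_num at h1 h2 h3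
  have h4 : p.coeff 0 = 0 := by linarith
  have h5 : p.coeff 1 = 0 := by linarith
  rw [eq_X_add_C_of_natDegree_le_one hp.1, h4, h5]
  simp

theorem IsSigmaInv.degree_two {p : ℝ[X]} (hp : IsSigmaInv 2 16 p) :
    p = C (p.coeff 0) * (1 + 14 * X + X ^ 2) := by
  have h1 := hp.2 (1 / 2) (by norm_num) (by norm_num) (by norm_num)
  have h3 := hp.2 2 (by norm_num) (by norm_num) (by norm_num)
  have h4 := hp.2 (1 / 5) (by norm_num) (by norm_num) (by norm_num)
  simp only [eval_eq_sum_range' (Nat.lt_succ_of_le hp.1), sum_range_succ, range_zero, sum_empty]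
    at h1 h3 h4
  norm_num at h1 h3 h4
  conv_lhs => rw [as_sum_range' p _ (Nat.lt_succ_of_le hp.1)]
  simp only [sum_range_succ, range_zero, sum_empty, ← C_mul_X_pow_eq_monomial]
  rw [show p.coeff 1 = 14 * p.coeff 0 by linarith, show p.coeff 2 = p.coeff 0 by linarith]
  simp only [C_mul, show C (14 : ℝ) = 14 from rfl]
  ring

theorem IsSigmaInv.degree_three {p : ℝ[X]} (hp : IsSigmaInv 3 (-64) p) :
    p = C (p.coeff 0) * (1 - 33 * X - 33 * X ^ 2 + X ^ 3) := by
  have h1 := hp.2 (1 / 2) (by norm_num) (by norm_num) (by norm_num)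
  have h2 := hp.2 (1 / 3) (by norm_num) (by norm_num) (by norm_num)
  have h3 := hp.2 2 (by norm_num) (by norm_num) (by norm_num)
  have h4 := hp.2 (1 / 5) (by norm_num) (by norm_num) (by norm_num)
  simp only [eval_eq_sum_range' (Nat.lt_succ_of_le hp.1), sum_range_succ, range_zero, sum_empty]
    at h1 h2 h3 h4
  norm_num at h1 h2 h3 h4
  conv_lhs => rw [as_sum_range' p _ (Nat.lt_succ_of_le hp.1)]
  simp only [sum_range_succ, range_zero, sum_empty, ← C_mul_X_pow_eq_monomial]
  rw [show p.coeff 1 = -33 * p.coeff 0 by linarith, show p.coeff 2 = -33 * p.coeff 0 by linarith,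
    show p.coeff 3 = p.coeff 0 by linarith]
  simp only [C_mul, C_neg, show C (33 : ℝ) = 33 from rfl]
  ring

theorem IsSigmaInv.degree_four {p : ℝ[X]} (hp : IsSigmaInv 4 256 p) :
    p = C (p.coeff 0) * (1 + 28 * X + 198 * X ^ 2 + 28 * X ^ 3 + X ^ 4) := by
  have h1 := hp.2 (1 / 2) (by norm_num) (by norm_num) (by norm_num)
  have h2 := hp.2 (1 / 5) (by norm_num) (by norm_num) (by norm_num)
  have h3 := hp.2 2 (by norm_num) (by norm_num) (by norm_num)
  have h4 := hp.2 5 (by norm_num) (by norm_num) (by norm_num)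
  have h5 := hp.2 3 (by norm_num) (by norm_num) (by norm_num)
  simp only [eval_eq_sum_range' (Nat.lt_succ_of_le hp.1), sum_range_succ, range_zero, sum_empty]
    at h1 h2 h3 h4 h5
  norm_num at h1 h2 h3 h4 h5
  conv_lhs => rw [as_sum_range' p _ (Nat.lt_succ_of_le hp.1)]
  simp only [sum_range_succ, range_zero, sum_empty, ← C_mul_X_pow_eq_monomial]
  rw [show p.coeff 1 = 28 * p.coeff 0 by linarith, show p.coeff 2 = 198 * p.coeff 0 by linarith,
    show p.coeff 3 = 28 * p.coeff 0 by linarith, show p.coeff 4 = p.coeff 0 by linarith]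
  simp only [C_mul, show C (28 : ℝ) = 28 from rfl, show C (198 : ℝ) = 198 from rfl]
  ring

end Invariants

end SupportDesign

namespace SupportDesign

/-! ### Residue relations for weight enumerators -/

section Residues

open PowerSeries

/-- The geometric series, the inverse of `1 - X`. -/
noncomputable def geom : ℝ⟦X⟧ := mk 1

theorem geom_mul : geom * (1 - X) = 1 := mk_one_mul_one_sub_eq_one ℝ

theorem coeff_geom_pow (d i : ℕ) : coeff i (geom ^ (d + 1)) = ((d + i).choose d : ℝ) := by
  rw [geom, mk_one_pow_eq_mk_choose_add, coeff_mk]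

theorem derivative_geom : derivative ℝ geom = geom ^ 2 := by
  have h := congrArg (derivative ℝ) geom_mul
  rw [Derivation.leibniz, map_sub, Derivation.map_one_eq_zero, derivative_X] at h
  simp only [smul_eq_mul] at h
  linear_combination geom * h - derivative ℝ geom * geom_mul

/-- The dehomogenized weight enumerator of the extended Hamming code of length `8`. -/
noncomputable def phi : ℝ⟦X⟧ := 1 + 14 * X + X ^ 2

/-- The polynomial occurring in the Jacobian of the two basic invariants. -/
noncomputable def jac : ℝ⟦X⟧ := 1 - 33 * X - 33 * X ^ 2 + X ^ 3

theorem derivative_phi : derivative ℝ phi = 14 + 2 * X := by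
  have h : (14 : ℝ⟦X⟧) = C 14 := (map_ofNat (C (R := ℝ)) 14).symm
  rw [phi, map_add, map_add, Derivation.map_one_eq_zero, Derivation.leibniz, derivative_pow, h,
    derivative_C, derivative_X]
  simp only [smul_eq_mul]
  push_cast
  ring

/-- The residue of the derivative of `(g / X) ^ (s + 1)`, where `g = phi ^ 3 * geom ^ 4`,
vanishes. -/
theorem coeff_residue (s : ℕ) :
    coeff (s + 1) (phi ^ (3 * s + 2) * geom ^ (4 * s + 5) * jac) = 0 := by
  set g : ℝ⟦X⟧ := phi ^ 3 * geom ^ 4 with hg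
  have h1 : derivative ℝ g = 3 * phi ^ 2 * (14 + 2 * X) * geom ^ 4 + 4 * phi ^ 3 * geom ^ 5 := by
    rw [hg, Derivation.leibniz, derivative_pow, derivative_pow, derivative_phi, derivative_geom]
    simp only [smul_eq_mul]
    push_cast
    ring
  -- Up to a power of X, this is minus the derivative of g / X, and it is where `jac` enters.
  have h2 : g - X * derivative ℝ g = phi ^ 2 * geom ^ 5 * jac := by
    have h3 : phi * (1 - X) - 3 * X * (14 + 2 * X) * (1 - X) - 4 * X * phi = jac := by
      rw [phi, jac]; ring
    rw [h1, ← h3, hg]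
    linear_combination phi ^ 2 * geom ^ 4 * (3 * X * (14 + 2 * X) - phi) * geom_mul
  have h4 : phi ^ (3 * s + 2) * geom ^ (4 * s + 5) * jac = g ^ (s + 1) - X * (g ^ s * derivative ℝ g) := by
    rw [pow_succ g, show g ^ s * g - X * (g ^ s * derivative ℝ g) =
      g ^ s * (g - X * derivative ℝ g) by ring, h2, hg]
    ring
  have h5 : coeff s (derivative ℝ (g ^ (s + 1))) = (s + 1) * coeff s (g ^ s * derivative ℝ g) := by
    rw [derivative_pow, Nat.add_sub_cancel, mul_assoc,
      show ((s + 1 : ℕ) : ℝ⟦X⟧) = C ((s : ℝ) + 1) by simp, coeff_C_mul]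
  rw [coeff_derivative] at h5
  rw [h4, map_sub, coeff_succ_X_mul]
  have h6 : (s : ℝ) + 1 ≠ 0 := by positivity
  refine mul_left_cancel₀ h6 ?_
  linear_combination h5

theorem coe_one_sub_X : ((1 - Polynomial.X : Polynomial ℝ) : ℝ⟦X⟧) = 1 - X := by
  rw [Polynomial.coe_sub, Polynomial.coe_one, Polynomial.coe_X]

theorem isSigmaInv_phi : IsSigmaInv 2 16 (1 + 14 * Polynomial.X + Polynomial.X ^ 2) := by
  refine ⟨by compute_degree, fun t h0 h1 h2 => ?_⟩
  have ht : 1 + t ≠ 0 := fun h => h2 (by linarith)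
  simp only [Polynomial.eval_add, Polynomial.eval_mul, Polynomial.eval_pow, Polynomial.eval_X,
    Polynomial.eval_one, Polynomial.eval_ofNat]
  field_simp
  ring

theorem isSigmaInv_phi_pow (j : ℕ) : IsSigmaInv (6 * j + 2) (2 ^ (12 * j + 4))
    ((1 + 14 * Polynomial.X + Polynomial.X ^ 2) ^ (3 * j + 1)) := by
  have h := isSigmaInv_phi.pow (3 * j + 1)
  rwa [show (3 * j + 1) * 2 = 6 * j + 2 by ring, show (16 : ℝ) = 2 ^ 4 by norm_num, ← pow_mul,
    show 4 * (3 * j + 1) = 12 * j + 4 by ring] at h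

theorem coe_phi_pow (N : ℕ) :
    (((1 + 14 * Polynomial.X + Polynomial.X ^ 2) ^ N : Polynomial ℝ) : ℝ⟦X⟧) = phi ^ N := by
  rw [Polynomial.coe_pow]
  congr 1
  rw [phi, Polynomial.coe_add, Polynomial.coe_add, Polynomial.coe_one, Polynomial.coe_mul,
    Polynomial.coe_pow, Polynomial.coe_X]
  have h := map_ofNat (Polynomial.coeToPowerSeries.ringHom (R := ℝ)) 14
  rw [Polynomial.coeToPowerSeries.ringHom_apply] at h
  rw [h]

/-- An invariant without constant term is divisible by `X`, with a quotient to which the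
divisibility by powers of `1 - X` applies. -/
theorem IsSigmaInv.exists_eq_X_mul {d : ℕ} {c : ℝ} {p : Polynomial ℝ}
    (hp : IsSigmaInv (d + 2) c p) (h0 : p.coeff 0 = 0) :
    ∃ q : Polynomial ℝ, p = Polynomial.X * q ∧ q.natDegree ≤ d ∧
      ∀ t : ℝ, t ≠ 0 → t ≠ 1 → t ≠ -1 → (1 + t) ^ (4 * d + 2 * 4) * (((1 - t) / (1 + t)) ^ 4 *
        q.eval (((1 - t) / (1 + t)) ^ 4)) = c * (t ^ 4 * q.eval (t ^ 4)) := by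
  obtain ⟨q, rfl⟩ := Polynomial.X_dvd_iff.2 h0
  refine ⟨q, rfl, ?_, fun t h0 h1 h2 => ?_⟩
  -- By palindromicity the top coefficient vanishes together with the constant term, so dividing by
  -- X lowers the degree bound by two.
  · have h1 := hp.coeff_eq
    rw [h0, Polynomial.coeff_X_mul] at h1
    rw [Polynomial.natDegree_le_iff_coeff_eq_zero]
    intro N hN
    rcases (Nat.succ_le_of_lt hN).eq_or_lt with h | h
    · rw [← h]; exact h1
    · rw [← Polynomial.coeff_X_mul]
      exact Polynomial.coeff_eq_zero_of_natDegree_lt (by have := hp.1; omega)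
  · have := hp.2 t h0 h1 h2
    simp only [Polynomial.eval_mul, Polynomial.eval_X] at this
    exact this

theorem coeff_zero_phi_pow (N : ℕ) :
    ((1 + 14 * Polynomial.X + Polynomial.X ^ 2 : Polynomial ℝ) ^ N).coeff 0 = 1 := by
  rw [Polynomial.coeff_zero_eq_eval_zero]
  simp

theorem coeff_residue_phi_pow (b : ℝ) (j q : ℕ) :
    coeff (j + 1 + q) (((Polynomial.C b * (1 + 14 * Polynomial.X + Polynomial.X ^ 2) ^ (3 * j + 1) :
      Polynomial ℝ) : ℝ⟦X⟧) * (phi ^ (1 + 3 * q) * jac * geom ^ (4 * j + 5 + 4 * q))) = 0 := by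
  rw [Polynomial.coe_mul, Polynomial.coe_C, coe_phi_pow, mul_assoc, coeff_C_mul,
    show phi ^ (3 * j + 1) * (phi ^ (1 + 3 * q) * jac * geom ^ (4 * j + 5 + 4 * q)) =
      phi ^ (3 * (j + q) + 2) * geom ^ (4 * (j + q) + 5) * jac by ring,
    show j + 1 + q = j + q + 1 by ring, SupportDesign.coeff_residue, mul_zero]

/-- The residue relations for invariants of degree `24j + 8`. -/
theorem IsSigmaInv.coeff_residue {j : ℕ} {p : Polynomial ℝ}
    (hp : IsSigmaInv (6 * j + 2) (2 ^ (12 * j + 4)) p) (q : ℕ) :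
    coeff (j + 1 + q) ((p : ℝ⟦X⟧) * (phi ^ (1 + 3 * q) * jac * geom ^ (4 * j + 5 + 4 * q))) = 0 := by
  -- Removing the constant term with a multiple of phi^(3j+1) leaves X(1 - X)^4 times an invariant
  -- of lower degree, as in Gleason's theorem. The factor (1 - X)^4 is absorbed by `geom` and X
  -- lowers the coefficient index.
  induction j generalizing p q with
  | zero =>
    obtain ⟨r, hr, hr1, hr2⟩ := (hp.sub ((isSigmaInv_phi_pow 0).const_mul (p.coeff 0))).exists_eq_X_mul
      (by rw [Polynomial.coeff_sub, Polynomial.coeff_C_mul, coeff_zero_phi_pow]; ring)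
    rw [eq_zero_of_natDegree_lt hr1 (by norm_num) (by positivity) hr2, mul_zero Polynomial.X,
      sub_eq_zero] at hr
    rw [hr]
    exact coeff_residue_phi_pow _ 0 q
  | succ j ih =>
    obtain ⟨r, hr, hr1, hr2⟩ := (hp.sub ((isSigmaInv_phi_pow (j + 1)).const_mul
      (p.coeff 0))).exists_eq_X_mul
      (by rw [Polynomial.coeff_sub, Polynomial.coeff_C_mul, coeff_zero_phi_pow]; ring)
    obtain ⟨v, rfl, hv⟩ := exists_isSigmaInv_quotient (d := 6 * j + 2) (e := 4)
      (hr1.trans (by omega)) (by positivity) hr2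
    rw [show (2 : ℝ) ^ (12 * (j + 1) + 4) / 8 ^ 4 = 2 ^ (12 * j + 4) by
      rw [show 12 * (j + 1) + 4 = 12 * j + 4 + 12 by ring, pow_add]; norm_num] at hv
    have h1 := coeff_residue_phi_pow (p.coeff 0) (j + 1) q
    rw [← sub_eq_zero, sub_sub, sub_eq_zero] at hr
    rw [hr, Polynomial.coe_add, add_mul, map_add, h1, zero_add, Polynomial.coe_mul,
      Polynomial.coe_mul, Polynomial.coe_X, Polynomial.coe_pow, coe_one_sub_X,
      show (X : ℝ⟦X⟧) * ((1 - X) ^ 4 * (v : ℝ⟦X⟧)) *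
        (phi ^ (1 + 3 * q) * jac * geom ^ (4 * (j + 1) + 5 + 4 * q)) =
        X * ((geom * (1 - X)) ^ 4 * ((v : ℝ⟦X⟧) *
          (phi ^ (1 + 3 * q) * jac * geom ^ (4 * j + 5 + 4 * q)))) by ring,
      geom_mul, one_pow, one_mul, show j + 1 + 1 + q = j + 1 + q + 1 by ring, coeff_succ_X_mul]
    exact ih hv q

end Residues

end SupportDesign

namespace SupportDesign

/-! ### Coefficients of (1 - X)^N times the low-degree invariants -/

section Coefficients

open Polynomial

theorem coeff_X_mul_one_sub_X_pow (N j : ℕ) :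
    ((N : ℝ) + 1) * (X * (1 - X : ℝ[X]) ^ N).coeff j = -j * ((1 - X : ℝ[X]) ^ (N + 1)).coeff j := by
  cases j with
  | zero => simp
  | succ j =>
    have h : derivative ((1 - X : ℝ[X]) ^ (N + 1)) = -(C ((N : ℝ) + 1) * (1 - X) ^ N) := by
      rw [derivative_pow_succ, derivative_sub, derivative_one, derivative_X]
      ring
    have h1 := congrArg (fun p => coeff p j) h
    simp only [coeff_derivative, coeff_neg, coeff_C_mul] at h1
    rw [coeff_X_mul]
    push_cast
    linear_combination h1

theorem coeff_one_sub_X_pow_succ (N j : ℕ) :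
    ((N : ℝ) + 1) * ((1 - X : ℝ[X]) ^ N).coeff j =
      (N + 1 - j) * ((1 - X : ℝ[X]) ^ (N + 1)).coeff j := by
  have h1 := coeff_X_mul_one_sub_X_pow N j
  have h2 : ((1 - X : ℝ[X]) ^ (N + 1)).coeff j =
      ((1 - X : ℝ[X]) ^ N).coeff j - (X * (1 - X : ℝ[X]) ^ N).coeff j := by
    rw [← coeff_sub]; congr 1; ring
  linear_combination -((N : ℝ) + 1) * h2 + h1

theorem coeff_one_sub_X_pow_add (N e j : ℕ) :
    (∏ a ∈ range e, ((N : ℝ) + e - a)) * ((1 - X : ℝ[X]) ^ N).coeff j =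
      (∏ a ∈ range e, ((N : ℝ) + e - j - a)) * ((1 - X : ℝ[X]) ^ (N + e)).coeff j := by
  induction e with
  | zero => simp
  | succ e ih =>
    have h := coeff_one_sub_X_pow_succ (N + e) j
    rw [prod_range_succ', prod_range_succ']
    push_cast at h ⊢
    have h1 : ∀ a ∈ range e, (N : ℝ) + (e + 1) - (a + 1) = N + e - a := fun a _ => by ring
    have h2 : ∀ a ∈ range e, (N : ℝ) + (e + 1) - j - (a + 1) = N + e - j - a := fun a _ => by ring
    rw [prod_congr rfl h1, prod_congr rfl h2, ← add_assoc N e 1]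
    linear_combination ((N : ℝ) + (e + 1)) * ih + (∏ a ∈ range e, ((N : ℝ) + e - j - a)) * h

/-- All products X^i (1 - X)^N with the same i + e become polynomial multiples in j of one signed
binomial coefficient. Linear combinations of them can then be collected into a single factor. -/
theorem coeff_X_pow_mul_one_sub_X_pow (N i e j : ℕ) :
    (∏ a ∈ range (i + e), ((N : ℝ) + (i + e) - a)) * (X ^ i * (1 - X : ℝ[X]) ^ N).coeff j =
      (-1) ^ i * (∏ a ∈ range i, ((j : ℝ) - a)) * (∏ a ∈ range e, ((N : ℝ) + (i + e) - j - a)) *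
        ((1 - X : ℝ[X]) ^ (N + (i + e))).coeff j := by
  induction i generalizing j with
  | zero =>
    have := coeff_one_sub_X_pow_add N e j
    simpa using this
  | succ i ih =>
    cases j with
    | zero =>
      rw [pow_succ', mul_assoc, mul_coeff_zero, coeff_X_zero, prod_range_succ' _ i]
      simp
    | succ j =>
      have h := coeff_X_mul_one_sub_X_pow (N + (i + e)) (j + 1)
      rw [coeff_X_mul] at h
      rw [pow_succ', mul_assoc, coeff_X_mul, show i + 1 + e = i + e + 1 by ring, prod_range_succ',
        prod_range_succ']
      push_cast at h ⊢
      have h1 : ∀ a ∈ range (i + e), (N : ℝ) + (i + 1 + e) - (a + 1) = N + (i + e) - a :=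
        fun a _ => by ring
      have h2 : ∀ a ∈ range i, (j : ℝ) + 1 - (a + 1) = j - a := fun a _ => by ring
      have h3 : ∀ a ∈ range e, (N : ℝ) + (i + 1 + e) - (j + 1) - a = N + (i + e) - j - a :=
        fun a _ => by ring
      rw [prod_congr rfl h1, prod_congr rfl h2, prod_congr rfl h3, ← add_assoc N]
      linear_combination ((N : ℝ) + (i + 1 + e)) * ih j + (-1) ^ i *
        (∏ a ∈ range i, ((j : ℝ) - a)) * (∏ a ∈ range e, ((N : ℝ) + (i + e) - j - a)) * h

/-- With i = j and exponent 0 in the previous identity, the left side is a product of positive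
factors. -/
theorem coeff_one_sub_X_pow_ne_zero {N j : ℕ} (hj : j ≤ N) :
    ((1 - X : ℝ[X]) ^ N).coeff j ≠ 0 := by
  have h := coeff_X_pow_mul_one_sub_X_pow 0 j (N - j) j
  have h1 : (X ^ j * (1 - X : ℝ[X]) ^ 0).coeff j = 1 := by simp
  rw [h1, mul_one, Nat.zero_add, Nat.add_sub_cancel' hj] at h
  intro h0
  rw [h0, mul_zero, prod_eq_zero_iff] at h
  obtain ⟨a, ha, h⟩ := h
  rw [mem_range] at ha
  have h2 : (N : ℝ) = a := by
    push_cast [Nat.cast_sub hj] at h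
    linarith
  have : N = a := by exact_mod_cast h2
  omega

theorem coeff_mul_quadratic (N j : ℕ) :
    ((N : ℝ) + 2) * (N + 1) * ((1 - X : ℝ[X]) ^ N * (1 + 14 * X + X ^ 2)).coeff j =
      ((1 - X : ℝ[X]) ^ (N + 2)).coeff j * (((N : ℝ) + 2) ^ 2 - (N + 2) - 16 * (j * (N + 2 - j))) := by
  have h0 := coeff_X_pow_mul_one_sub_X_pow N 0 2 j
  have h1 := coeff_X_pow_mul_one_sub_X_pow N 1 1 j
  have h2 := coeff_X_pow_mul_one_sub_X_pow N 2 0 j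
  have h : ((1 - X : ℝ[X]) ^ N * (1 + 14 * X + X ^ 2)).coeff j =
      (X ^ 0 * (1 - X : ℝ[X]) ^ N).coeff j + 14 * (X ^ 1 * (1 - X : ℝ[X]) ^ N).coeff j +
      (X ^ 2 * (1 - X : ℝ[X]) ^ N).coeff j := by
    rw [← coeff_C_mul, ← coeff_add, ← coeff_add]
    congr 1
    rw [show C (14 : ℝ) = 14 from rfl]
    ring
  simp only [prod_range_succ, range_zero, prod_empty, Nat.cast_zero, Nat.cast_one, Nat.cast_ofNat,
    Nat.reduceAdd] at h0 h1 h2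
  rw [h]
  linear_combination h0 + 14 * h1 + h2

theorem coeff_mul_cubic (N j : ℕ) :
    ((N : ℝ) + 3) * (N + 2) * (N + 1) *
      ((1 - X : ℝ[X]) ^ N * (1 - 33 * X - 33 * X ^ 2 + X ^ 3)).coeff j =
      ((1 - X : ℝ[X]) ^ (N + 3)).coeff j * (((N : ℝ) + 3 - 2 * j) *
        ((N + 2) * (N + 1) + 32 * (j * (N + 3 - j)))) := by
  have h0 := coeff_X_pow_mul_one_sub_X_pow N 0 3 j
  have h1 := coeff_X_pow_mul_one_sub_X_pow N 1 2 j
  have h2 := coeff_X_pow_mul_one_sub_X_pow N 2 1 j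
  have h3 := coeff_X_pow_mul_one_sub_X_pow N 3 0 j
  have h : ((1 - X : ℝ[X]) ^ N * (1 - 33 * X - 33 * X ^ 2 + X ^ 3)).coeff j =
      (X ^ 0 * (1 - X : ℝ[X]) ^ N).coeff j - 33 * (X ^ 1 * (1 - X : ℝ[X]) ^ N).coeff j -
      33 * (X ^ 2 * (1 - X : ℝ[X]) ^ N).coeff j + (X ^ 3 * (1 - X : ℝ[X]) ^ N).coeff j := by
    rw [← coeff_C_mul, ← coeff_C_mul, ← coeff_sub, ← coeff_sub, ← coeff_add]
    congr 1
    rw [show C (33 : ℝ) = 33 from rfl]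
    ring
  simp only [prod_range_succ, range_zero, prod_empty, Nat.cast_zero, Nat.cast_one, Nat.cast_ofNat,
    Nat.reduceAdd] at h0 h1 h2 h3
  rw [h]
  linear_combination h0 - 33 * h1 - 33 * h2 + h3

theorem coeff_mul_quartic (N j : ℕ) :
    ((N : ℝ) + 4) * (N + 3) * (N + 2) * (N + 1) *
      ((1 - X : ℝ[X]) ^ N * (1 + 28 * X + 198 * X ^ 2 + 28 * X ^ 3 + X ^ 4)).coeff j =
      ((1 - X : ℝ[X]) ^ (N + 4)).coeff j * (256 * (j * (N + 4 - j)) ^ 2 -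
        (32 * ((N : ℝ) + 4) ^ 2 + 96 * (N + 4) - 64) * (j * (N + 4 - j)) +
        (N + 4) * (N + 3) * (N + 2) * (N + 1)) := by
  have h0 := coeff_X_pow_mul_one_sub_X_pow N 0 4 j
  have h1 := coeff_X_pow_mul_one_sub_X_pow N 1 3 j
  have h2 := coeff_X_pow_mul_one_sub_X_pow N 2 2 j
  have h3 := coeff_X_pow_mul_one_sub_X_pow N 3 1 j
  have h4 := coeff_X_pow_mul_one_sub_X_pow N 4 0 j
  have h : ((1 - X : ℝ[X]) ^ N * (1 + 28 * X + 198 * X ^ 2 + 28 * X ^ 3 + X ^ 4)).coeff j =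
      (X ^ 0 * (1 - X : ℝ[X]) ^ N).coeff j + 28 * (X ^ 1 * (1 - X : ℝ[X]) ^ N).coeff j +
      198 * (X ^ 2 * (1 - X : ℝ[X]) ^ N).coeff j + 28 * (X ^ 3 * (1 - X : ℝ[X]) ^ N).coeff j +
      (X ^ 4 * (1 - X : ℝ[X]) ^ N).coeff j := by
    rw [← coeff_C_mul, ← coeff_C_mul, ← coeff_C_mul, ← coeff_add, ← coeff_add, ← coeff_add,
      ← coeff_add]
    congr 1
    rw [show C (28 : ℝ) = 28 from rfl, show C (198 : ℝ) = 198 from rfl]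
    ring
  simp only [prod_range_succ, range_zero, prod_empty, Nat.cast_zero, Nat.cast_one, Nat.cast_ofNat,
    Nat.reduceAdd] at h0 h1 h2 h3 h4
  rw [h]
  linear_combination h0 + 28 * h1 + 198 * h2 + 28 * h3 + h4

end Coefficients

/-! ### Block sums of harmonic functions -/

section HarmonicEnumerators

open Polynomial

variable {m : ℕ} {C : Submodule (ZMod 2) (Fin (24 * m + 8) → ZMod 2)}

/-- The polynomial whose coefficients are the block sums of `f`. -/
noncomputable def blockPoly (C : Submodule (ZMod 2) (Fin (24 * m + 8) → ZMod 2)) (k : ℕ)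
    (f : Finset (Fin (24 * m + 8)) → ℝ) : ℝ[X] :=
  ∑ j ∈ range (4 * m + 1), Polynomial.C (blockSum C k f j) * X ^ j

theorem natDegree_blockPoly (k : ℕ) (f : Finset (Fin (24 * m + 8)) → ℝ) :
    (blockPoly C k f).natDegree ≤ 4 * m :=
  natDegree_sum_le_of_forall_le _ _ fun j hj =>
    (natDegree_C_mul_X_pow_le _ j).trans (Nat.lt_succ_iff.1 (mem_range.1 hj))

theorem coeff_blockPoly (k : ℕ) (f : Finset (Fin (24 * m + 8)) → ℝ) {j : ℕ} (hj : j ≤ 4 * m) :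
    (blockPoly C k f).coeff j = blockSum C k f j := by
  rw [blockPoly, finsetSum_coeff]
  simp only [coeff_C_mul_X_pow]
  rw [Finset.sum_ite_eq, if_pos (mem_range.2 (by omega))]

/-- The factor t^k in the MacWilliams identity cancels against t^(4m+4), leaving t^e with e = 4m + 4
- k. -/
theorem IsExtremalTypeII.blockPoly_sigma (hC : IsExtremalTypeII C) {k e : ℕ} (hk : k ≠ 0)
    (hke : k + e = 4 * m + 4) {f : Finset (Fin (24 * m + 8)) → ℝ} (hf : IsHarmonic k f) (t : ℝ)
    (h0 : t ≠ 0) (h1 : t ≠ 1) (h2 : t ≠ -1) :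
    (1 + t) ^ (4 * (4 * m) + 2 * e) *
      (((1 - t) / (1 + t)) ^ e * (blockPoly C k f).eval (((1 - t) / (1 + t)) ^ 4)) =
      (2 ^ (12 * m + 4) / (-2) ^ k) * (t ^ e * (blockPoly C k f).eval (t ^ 4)) := by
  have ht1 : 1 + t ≠ 0 := fun h => h2 (by linarith)
  have ht2 : 1 - t ≠ 0 := sub_ne_zero.2 h1.symm
  have hE : ∀ t : ℝ, weightEnum C k f t = t ^ (4 * m + 4) * (blockPoly C k f).eval (t ^ 4) := by
    intro t
    rw [hC.weightEnum_eq hk hf, blockPoly, eval_finsetSum]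
    simp
  have h := macWilliams hC.selfDual hf ht1 ht2
  rw [hE, hE, hC.card_words, ← hke, pow_add, pow_add] at h
  have h3 : (1 + t) ^ (24 * m + 8) = (1 + t) ^ (4 * (4 * m) + 2 * e) * ((1 + t) ^ 2) ^ k := by
    rw [← pow_mul, ← pow_add]; congr 1; omega
  have h4 : (-(2 * t) / ((1 - t) * (1 + t))) ^ k * ((1 + t) ^ 2) ^ k * ((1 - t) / (1 + t)) ^ k =
      (-2) ^ k * t ^ k := by
    rw [← mul_pow, ← mul_pow, ← mul_pow]
    congr 1
    field_simp
  rw [h3] at h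
  rw [div_mul_eq_mul_div, eq_div_iff (by positivity)]
  refine mul_left_cancel₀ (pow_ne_zero k h0) ?_
  linear_combination -h - (1 + t) ^ (4 * (4 * m) + 2 * e) * ((1 - t) / (1 + t)) ^ e *
    (blockPoly C k f).eval (((1 - t) / (1 + t)) ^ 4) * h4

/-- For k < 4 the forced power of 1 - X has exponent 4m + 4 - k > 4m, exceeding the degree bound. -/
theorem IsExtremalTypeII.blockPoly_eq_zero (hC : IsExtremalTypeII C) {k : ℕ} (hk : k ≠ 0)
    (hk4 : k < 4) {f : Finset (Fin (24 * m + 8)) → ℝ} (hf : IsHarmonic k f) :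
    blockPoly C k f = 0 :=
  eq_zero_of_natDegree_lt (natDegree_blockPoly k f) (e := 4 * m + 4 - k)
    (c := 2 ^ (12 * m + 4) / (-2) ^ k) (by omega)
    (by positivity)
    fun t h0 h1 h2 => hC.blockPoly_sigma hk (by omega) hf t h0 h1 h2

theorem IsExtremalTypeII.exists_blockPoly_eq (hC : IsExtremalTypeII C) {d e : ℕ}
    (hde : d + e = 4 * m) {f : Finset (Fin (24 * m + 8)) → ℝ} (hf : IsHarmonic (d + 4) f) :
    ∃ q : ℝ[X], blockPoly C (d + 4) f = (1 - X) ^ e * q ∧ IsSigmaInv d ((-4) ^ d) q := by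
  have h := exists_isSigmaInv_quotient (d := d) (e := e) (c := 2 ^ (12 * m + 4) / (-2) ^ (d + 4))
    ((natDegree_blockPoly (C := C) (d + 4) f).trans hde.ge) (by positivity)
    fun t h0 h1 h2 => by
      rw [hde]; exact hC.blockPoly_sigma (by omega) (by omega) hf t h0 h1 h2
  convert h using 4
  rw [show 12 * m + 4 = 3 * d + 3 * e + 4 by omega, pow_add, pow_add, pow_add (-2 : ℝ), pow_mul,
    pow_mul, div_div, eq_div_iff (by positivity),
    show (2 : ℝ) ^ 3 = (-4) * (-2) by norm_num, mul_pow (-4 : ℝ) (-2) d]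
  norm_num
  ring

theorem IsExtremalTypeII.blockSum_five (hC : IsExtremalTypeII C) (hm : m ≠ 0)
    {f : Finset (Fin (24 * m + 8)) → ℝ} (hf : IsHarmonic 5 f) {j : ℕ} (hj : j ≤ 4 * m) :
    blockSum C 5 f j = 0 := by
  obtain ⟨q, hq, hq'⟩ := hC.exists_blockPoly_eq (d := 1) (e := 4 * m - 1) (by omega) hf
  rw [pow_one] at hq'
  rw [← coeff_blockPoly 5 f hj, hq, hq'.degree_one]
  simp

theorem IsExtremalTypeII.blockSum_of_lt_four (hC : IsExtremalTypeII C) {k : ℕ} (hk : k ≠ 0)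
    (hk4 : k < 4) {f : Finset (Fin (24 * m + 8)) → ℝ} (hf : IsHarmonic k f) {j : ℕ}
    (hj : j ≤ 4 * m) : blockSum C k f j = 0 := by
  rw [← coeff_blockPoly k f hj, hC.blockPoly_eq_zero hk hk4 hf, coeff_zero]

/-- The factor which decides whether the block sums of degree `6` at the weight `4m + 4 + 4j`
vanish. -/
def factorSix (m j : ℕ) : ℤ := (4 * m : ℤ) ^ 2 - 4 * m - 16 * (j * (4 * m - j))

/-- The factor for degree `7`. -/
def factorSeven (m j : ℕ) : ℤ :=
  (4 * m - 2 * j) * ((4 * m - 1) * (4 * m - 2) + 32 * (j * (4 * m - j)))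

/-- The factor for degree `8`. -/
def factorEight (m j : ℕ) : ℤ :=
  256 * ((j : ℤ) * (4 * m - j)) ^ 2 - (32 * (4 * m) ^ 2 + 96 * (4 * m) - 64) * (j * (4 * m - j)) +
    4 * m * (4 * m - 1) * (4 * m - 2) * (4 * m - 3)

theorem IsExtremalTypeII.blockSum_four (hC : IsExtremalTypeII C)
    {f : Finset (Fin (24 * m + 8)) → ℝ} (hf : IsHarmonic 4 f) :
    ∃ r : ℝ, ∀ j ≤ 4 * m, ∃ c : ℝ, c ≠ 0 ∧ blockSum C 4 f j = r * (c * (1 : ℤ)) := by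
  obtain ⟨q, hq, hq'⟩ := hC.exists_blockPoly_eq (d := 0) (e := 4 * m) (by omega) hf
  refine ⟨q.coeff 0, fun j hj => ⟨_, coeff_one_sub_X_pow_ne_zero hj, ?_⟩⟩
  rw [← coeff_blockPoly 4 f hj, hq, hq'.eq_C, coeff_mul_C]
  simp [mul_comm]

theorem IsExtremalTypeII.blockSum_six (hC : IsExtremalTypeII C) (hm : m ≠ 0)
    {f : Finset (Fin (24 * m + 8)) → ℝ} (hf : IsHarmonic 6 f) :
    ∃ r : ℝ, ∀ j ≤ 4 * m, ∃ c : ℝ, c ≠ 0 ∧ blockSum C 6 f j = r * (c * factorSix m j) := by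
  obtain ⟨N, hN⟩ : ∃ N, 4 * m = N + 2 := ⟨4 * m - 2, by omega⟩
  have hN' : (4 * m : ℝ) = N + 2 := by exact_mod_cast hN
  obtain ⟨q, hq, hq'⟩ := hC.exists_blockPoly_eq (d := 2) (e := N) (by omega) hf
  norm_num at hq'
  refine ⟨q.coeff 0, fun j hj => ⟨((1 - X : ℝ[X]) ^ (N + 2)).coeff j / (((N : ℝ) + 2) * (N + 1)),
    div_ne_zero (coeff_one_sub_X_pow_ne_zero (hN ▸ hj)) (by positivity), ?_⟩⟩
  rw [← coeff_blockPoly 6 f hj, hq, hq'.degree_two, mul_left_comm, coeff_C_mul]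
  have h := coeff_mul_quadratic N j
  congr 1
  · simp
  rw [div_mul_eq_mul_div, eq_div_iff (by positivity), mul_comm, h, factorSix]
  push_cast
  rw [hN']

theorem IsExtremalTypeII.blockSum_seven (hC : IsExtremalTypeII C) (hm : m ≠ 0)
    {f : Finset (Fin (24 * m + 8)) → ℝ} (hf : IsHarmonic 7 f) :
    ∃ r : ℝ, ∀ j ≤ 4 * m, ∃ c : ℝ, c ≠ 0 ∧ blockSum C 7 f j = r * (c * factorSeven m j) := by
  obtain ⟨N, hN⟩ : ∃ N, 4 * m = N + 3 := ⟨4 * m - 3, by omega⟩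
  have hN' : (4 * m : ℝ) = N + 3 := by exact_mod_cast hN
  obtain ⟨q, hq, hq'⟩ := hC.exists_blockPoly_eq (d := 3) (e := N) (by omega) hf
  norm_num at hq'
  refine ⟨q.coeff 0, fun j hj => ⟨((1 - X : ℝ[X]) ^ (N + 3)).coeff j /
    (((N : ℝ) + 3) * (N + 2) * (N + 1)),
    div_ne_zero (coeff_one_sub_X_pow_ne_zero (hN ▸ hj)) (by positivity), ?_⟩⟩
  rw [← coeff_blockPoly 7 f hj, hq, hq'.degree_three, mul_left_comm, coeff_C_mul]
  have h := coeff_mul_cubic N j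
  congr 1
  · simp
  rw [div_mul_eq_mul_div, eq_div_iff (by positivity), mul_comm, h, factorSeven]
  push_cast
  rw [hN']
  ring

theorem IsExtremalTypeII.blockSum_eight (hC : IsExtremalTypeII C) (hm : m ≠ 0)
    {f : Finset (Fin (24 * m + 8)) → ℝ} (hf : IsHarmonic 8 f) :
    ∃ r : ℝ, ∀ j ≤ 4 * m, ∃ c : ℝ, c ≠ 0 ∧ blockSum C 8 f j = r * (c * factorEight m j) := by
  obtain ⟨N, hN⟩ : ∃ N, 4 * m = N + 4 := ⟨4 * m - 4, by omega⟩
  have hN' : (4 * m : ℝ) = N + 4 := by exact_mod_cast hN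
  obtain ⟨q, hq, hq'⟩ := hC.exists_blockPoly_eq (d := 4) (e := N) (by omega) hf
  norm_num at hq'
  refine ⟨q.coeff 0, fun j hj => ⟨((1 - X : ℝ[X]) ^ (N + 4)).coeff j /
    (((N : ℝ) + 4) * (N + 3) * (N + 2) * (N + 1)),
    div_ne_zero (coeff_one_sub_X_pow_ne_zero (hN ▸ hj)) (by positivity), ?_⟩⟩
  rw [← coeff_blockPoly 8 f hj, hq, hq'.degree_four, mul_left_comm, coeff_C_mul]
  have h := coeff_mul_quartic N j
  congr 1
  · simp
  rw [div_mul_eq_mul_div, eq_div_iff (by positivity), mul_comm, h, factorEight]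
  push_cast
  rw [hN']
  ring

end HarmonicEnumerators

end SupportDesign

namespace SupportDesign

/-! ### Coefficients of powers of the geometric series -/

section GeomCoefficients

open PowerSeries

/-- The counterpart for 1/(1 - X)^(d+1): shifting by X^i multiplies a binomial coefficient by a
rational function of j. -/
theorem coeff_X_pow_mul_geom_pow (d i j : ℕ) :
    (∏ a ∈ range i, ((j : ℝ) + d - a)) * coeff j (X ^ i * geom ^ (d + 1)) =
      (∏ a ∈ range i, ((j : ℝ) - a)) * coeff j (geom ^ (d + 1)) := by
  induction i generalizing j with
  | zero => simp
  | succ i ih =>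
    cases j with
    | zero =>
      rw [pow_succ', mul_assoc, coeff_zero_X_mul, prod_range_succ' (fun a => ((0 : ℕ) : ℝ) - a)]
      simp
    | succ j =>
      have h : ((j : ℝ) + d + 1) * coeff j (geom ^ (d + 1)) =
          (j + 1) * coeff (j + 1) (geom ^ (d + 1)) := by
        rw [coeff_geom_pow, coeff_geom_pow]
        have := Nat.choose_mul_succ_eq (d + j) d
        rw [show d + j + 1 - d = j + 1 by omega] at this
        have h := congrArg (Nat.cast : ℕ → ℝ) this
        push_cast at h
        rw [← add_assoc d j 1]
        linear_combination h
      rw [pow_succ', mul_assoc, coeff_succ_X_mul, prod_range_succ', prod_range_succ']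
      push_cast
      have h1 : ∀ a ∈ range i, (j : ℝ) + 1 + d - (a + 1) = j + d - a := fun a _ => by ring
      have h2 : ∀ a ∈ range i, (j : ℝ) + 1 - (a + 1) = j - a := fun a _ => by ring
      rw [prod_congr rfl h1, prod_congr rfl h2]
      linear_combination ((j : ℝ) + d + 1) * ih j + (∏ a ∈ range i, ((j : ℝ) - a)) * h

theorem coeff_X_pow_mul_geom_pow_of_le (d i D j : ℕ) (hiD : i ≤ D) :
    (∏ a ∈ range D, ((j : ℝ) + d - a)) * coeff j (X ^ i * geom ^ (d + 1)) =
      (∏ a ∈ range i, ((j : ℝ) - a)) * (∏ a ∈ range (D - i), ((j : ℝ) + d - i - a)) *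
        coeff j (geom ^ (d + 1)) := by
  obtain ⟨e, rfl⟩ := Nat.exists_eq_add_of_le hiD
  rw [Nat.add_sub_cancel_left, prod_range_add]
  have h : ∀ a ∈ range e, (j : ℝ) + d - ((i + a : ℕ) : ℝ) = j + d - i - a := fun a _ => by
    push_cast; ring
  rw [prod_congr rfl h]
  linear_combination (∏ a ∈ range e, ((j : ℝ) + d - i - a)) * coeff_X_pow_mul_geom_pow d i j

theorem coeff_phi_mul_jac (j d : ℕ) :
    coeff j (phi ^ (1 + 3 * 0) * jac * geom ^ (d + 1)) =
      coeff j (X ^ 0 * geom ^ (d + 1)) - 19 * coeff j (X ^ 1 * geom ^ (d + 1)) -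
      494 * coeff j (X ^ 2 * geom ^ (d + 1)) - 494 * coeff j (X ^ 3 * geom ^ (d + 1)) -
      19 * coeff j (X ^ 4 * geom ^ (d + 1)) + coeff j (X ^ 5 * geom ^ (d + 1)) := by
  simp only [← coeff_C_mul, ← map_sub, ← map_add]
  congr 1
  simp only [map_ofNat, phi, jac]
  ring

theorem coeff_phi_pow_four_mul_jac (j d : ℕ) :
    coeff j (phi ^ (1 + 3 * 1) * jac * geom ^ (d + 1)) =
      coeff j (X ^ 0 * geom ^ (d + 1)) + 23 * coeff j (X ^ 1 * geom ^ (d + 1)) -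
      701 * coeff j (X ^ 2 * geom ^ (d + 1)) - 29643 * coeff j (X ^ 3 * geom ^ (d + 1)) -
      365862 * coeff j (X ^ 4 * geom ^ (d + 1)) - 1700970 * coeff j (X ^ 5 * geom ^ (d + 1)) -
      1700970 * coeff j (X ^ 6 * geom ^ (d + 1)) - 365862 * coeff j (X ^ 7 * geom ^ (d + 1)) -
      29643 * coeff j (X ^ 8 * geom ^ (d + 1)) - 701 * coeff j (X ^ 9 * geom ^ (d + 1)) +
      23 * coeff j (X ^ 10 * geom ^ (d + 1)) + coeff j (X ^ 11 * geom ^ (d + 1)) := by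
  simp only [← coeff_C_mul, ← map_sub, ← map_add]
  congr 1
  simp only [map_ofNat, phi, jac]
  ring

end GeomCoefficients

/-! ### Numbers of codewords of the two smallest weights -/

section WeightDistribution

open Polynomial

variable {m : ℕ} {C : Submodule (ZMod 2) (Fin (24 * m + 8) → ZMod 2)}

/-- The polynomial whose coefficients are the numbers of codewords of the weights `4j`. -/
noncomputable def weightPoly (C : Submodule (ZMod 2) (Fin (24 * m + 8) → ZMod 2)) : ℝ[X] :=
  ∑ j ∈ range (6 * m + 3), Polynomial.C (#(supportDesign C (4 * j)) : ℝ) * X ^ j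

theorem coeff_weightPoly {j : ℕ} (hj : j ≤ 6 * m + 2) :
    (weightPoly C).coeff j = #(supportDesign C (4 * j)) := by
  rw [weightPoly, finsetSum_coeff]
  simp only [coeff_C_mul_X_pow]
  rw [Finset.sum_ite_eq, if_pos (mem_range.2 (by omega))]

theorem IsDoublyEven.weightEnum_zero (hC : IsDoublyEven C) (t : ℝ) :
    weightEnum C 0 (fun z => if z = ∅ then 1 else 0) t = (weightPoly C).eval (t ^ 4) := by
  have hmap : ∀ u ∈ words C, hammingNorm u / 4 ∈ range (6 * m + 3) := by
    intro u _
    have h : hammingNorm u ≤ 24 * m + 8 := by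
      rw [← card_supp]
      simpa using card_le_univ (supp u)
    rw [mem_range]
    omega
  rw [weightEnum, ← Finset.sum_fiberwise_of_maps_to hmap, weightPoly, eval_finsetSum]
  refine Finset.sum_congr rfl fun j _ => ?_
  have h1 : (#(supportDesign C (4 * j)) : ℝ) = ∑ u ∈ words C with hammingNorm u = 4 * j, 1 := by
    rw [← sum_supportDesign C (4 * j) fun _ => (1 : ℝ)]; simp
  have h2 : {u ∈ words C | hammingNorm u / 4 = j} = {u ∈ words C | hammingNorm u = 4 * j} := by
    refine filter_congr fun u hu => ?_
    have := hC u (mem_words.1 hu)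
    omega
  rw [h2, h1, eval_C_mul, eval_pow, eval_X, Finset.sum_mul]
  refine Finset.sum_congr rfl fun u hu => ?_
  rw [extend_zero_single, (mem_filter.1 hu).2, pow_mul]

theorem IsExtremalTypeII.isSigmaInv_weightPoly (hC : IsExtremalTypeII C) :
    IsSigmaInv (6 * m + 2) (2 ^ (12 * m + 4)) (weightPoly C) := by
  refine ⟨natDegree_sum_le_of_forall_le _ _ fun j hj =>
    (natDegree_C_mul_X_pow_le _ j).trans (Nat.lt_succ_iff.1 (mem_range.1 hj)),
    fun t _ h1 h2 => ?_⟩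
  have h := macWilliams hC.selfDual isHarmonic_zero_single (t := t) (fun h => h2 (by linarith))
    (sub_ne_zero.2 h1.symm)
  rw [hC.doublyEven.weightEnum_zero, hC.doublyEven.weightEnum_zero, hC.card_words, pow_zero, one_mul] at h
  rw [h]
  congr 2
  ring

theorem card_supportDesign_zero :
    #(supportDesign C (4 * 0)) = 1 := by
  have h : supportDesign C (4 * 0) = {∅} := by
    ext B
    simp only [supportDesign, mem_filter, mem_univ, true_and, mem_singleton, mul_zero,
      hammingNorm_eq_zero]
    constructor
    · rintro ⟨c, -, rfl, rfl⟩; simp [supp]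
    · rintro rfl; exact ⟨0, C.zero_mem, rfl, by simp [supp]⟩
  rw [h, card_singleton]

theorem IsExtremalTypeII.card_supportDesign_of_le (hC : IsExtremalTypeII C) {j : ℕ} (h0 : j ≠ 0)
    (hj : j ≤ m) : #(supportDesign C (4 * j)) = 0 := by
  rw [card_eq_zero, eq_empty_iff_forall_notMem]
  intro B hB
  simp only [supportDesign, mem_filter, mem_univ, true_and] at hB
  obtain ⟨c, hc, hw, rfl⟩ := hB
  have := hC.le_hammingNorm hc (by rintro rfl; rw [hammingNorm_zero] at hw; omega)
  omega

/-- No words have weights 4, …, 4m, so only the zero word contributes. -/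
theorem IsExtremalTypeII.coeff_weightPoly_mul (hC : IsExtremalTypeII C) (g : PowerSeries ℝ) (s : ℕ) :
    ∑ i ∈ range (m + 1), (weightPoly C).coeff i * PowerSeries.coeff (m + 1 + s - i) g =
      PowerSeries.coeff (m + 1 + s) g := by
  rw [Finset.sum_eq_single 0]
  · rw [coeff_weightPoly (by omega), card_supportDesign_zero]
    simp
  · intro i hi h0
    rw [mem_range] at hi
    rw [coeff_weightPoly (by omega), hC.card_supportDesign_of_le h0 (by omega)]
    simp
  · simp

theorem constantCoeff_phi_pow_mul (q K : ℕ) :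
    PowerSeries.coeff 0 (phi ^ q * jac * geom ^ K) = 1 := by
  have h1 : PowerSeries.constantCoeff phi = 1 := by simp [phi]
  have h2 : PowerSeries.constantCoeff jac = 1 := by simp [jac]
  have h3 : PowerSeries.constantCoeff geom = 1 := by simp [geom]
  simp [h1, h2, h3]

/-- The number of codewords of minimum weight as a residue. -/
theorem IsExtremalTypeII.card_min (hC : IsExtremalTypeII C) :
    PowerSeries.coeff (m + 1) (phi ^ (1 + 3 * 0) * jac * geom ^ (4 * m + 4 + 1)) +
      (#(supportDesign C (4 * (m + 1))) : ℝ) = 0 := by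
  have h := hC.isSigmaInv_weightPoly.coeff_residue 0
  rw [PowerSeries.coeff_mul, Finset.Nat.sum_antidiagonal_eq_sum_range_succ
    (fun a b => PowerSeries.coeff a (weightPoly C : PowerSeries ℝ) * PowerSeries.coeff b _)] at h
  simp only [Polynomial.coeff_coe] at h
  rw [sum_range_succ, add_zero, Nat.sub_self, constantCoeff_phi_pow_mul, mul_one,
    hC.coeff_weightPoly_mul _ 0, coeff_weightPoly (by omega)] at h
  exact h

theorem IsExtremalTypeII.card_next (hC : IsExtremalTypeII C) :
    PowerSeries.coeff (m + 2) (phi ^ (1 + 3 * 1) * jac * geom ^ (4 * m + 8 + 1)) +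
      (#(supportDesign C (4 * (m + 1))) : ℝ) * (4 * m + 32) + #(supportDesign C (4 * (m + 2))) = 0 := by
  have h := hC.isSigmaInv_weightPoly.coeff_residue 1
  rw [PowerSeries.coeff_mul, Finset.Nat.sum_antidiagonal_eq_sum_range_succ
    (fun a b => PowerSeries.coeff a (weightPoly C : PowerSeries ℝ) * PowerSeries.coeff b _)] at h
  simp only [Polynomial.coeff_coe] at h
  rw [sum_range_succ, Nat.sub_self, constantCoeff_phi_pow_mul,
    mul_one ((weightPoly C).coeff _), sum_range_succ,
    hC.coeff_weightPoly_mul _ 1, coeff_weightPoly (by omega),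
    coeff_weightPoly (by omega), show m + 1 + 1 - (m + 1) = 1 by omega] at h
  -- The linear coefficient is 4 · 14 - 33 + (4m + 9).
  have h1 : PowerSeries.coeff 1 (phi ^ (1 + 3 * 1) * jac * geom ^ (4 * m + 8 + 1)) =
      (4 * m + 32 : ℝ) := by
    rw [coeff_phi_pow_four_mul_jac]
    simp only [PowerSeries.coeff_X_pow_mul']
    norm_num [coeff_geom_pow]
    ring
  rw [show 4 * m + 5 + 4 * 1 = 4 * m + 8 + 1 by ring, h1] at h
  exact h

theorem choose_relation (a b m : ℕ) :
    (((5 * m + (a + b)).choose (4 * m + a) : ℕ) : ℝ) * (∏ i ∈ range a, ((4 * m : ℝ) + i + 1)) *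
      (∏ i ∈ range b, ((m : ℝ) + i + 1)) =
      (∏ i ∈ range (a + b), ((5 * m : ℝ) + i + 1)) * ((5 * m).choose m : ℕ) := by
  have hfac : ∀ N c : ℕ, ((N + c).factorial : ℝ) = N.factorial * ∏ i ∈ range c, ((N : ℝ) + i + 1) := by
    intro N c
    induction c with
    | zero => simp
    | succ c ih =>
      rw [← add_assoc, Nat.factorial_succ, prod_range_succ, Nat.cast_mul, ih]
      push_cast
      ring
  have h1 := Nat.add_choose_mul_factorial_mul_factorial (m + b) (4 * m + a)
  have h2 := Nat.add_choose_mul_factorial_mul_factorial (4 * m) m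
  rw [show m + b + (4 * m + a) = 5 * m + (a + b) by ring] at h1
  rw [show 4 * m + m = 5 * m by ring] at h2
  have h1' := congrArg (Nat.cast : ℕ → ℝ) h1
  have h2' := congrArg (Nat.cast : ℕ → ℝ) h2
  push_cast only [Nat.cast_mul] at h1' h2'
  rw [hfac, hfac, hfac] at h1'
  rw [← h2'] at h1'
  have h3 : ((m.factorial : ℝ) * ((4 * m).factorial : ℝ)) ≠ 0 := by positivity
  refine mul_left_cancel₀ h3 ?_
  push_cast at h1' ⊢
  linear_combination h1'

/-- The residue in `IsExtremalTypeII.card_min` is expanded over a common denominator and its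
binomial coefficient reduced to C(5m, m). -/
theorem IsExtremalTypeII.card_min_eq (hC : IsExtremalTypeII C) :
    (#(supportDesign C (4 * (m + 1))) : ℝ) *
      (4 * ((4 * m + 1) * (4 * m + 2) * (4 * m + 3) * (4 * m + 4))) =
      (24 * m + 8) * (24 * m + 7) * (24 * m + 6) * (24 * m + 4) * ((5 * m).choose m : ℕ) := by
  have h := hC.card_min
  have hc := choose_relation 4 1 m
  have hT := coeff_phi_mul_jac (m + 1) (4 * m + 4)
  have h0 := coeff_X_pow_mul_geom_pow_of_le (4 * m + 4) 0 5 (m + 1) (by norm_num)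
  have h1 := coeff_X_pow_mul_geom_pow_of_le (4 * m + 4) 1 5 (m + 1) (by norm_num)
  have h2 := coeff_X_pow_mul_geom_pow_of_le (4 * m + 4) 2 5 (m + 1) (by norm_num)
  have h3 := coeff_X_pow_mul_geom_pow_of_le (4 * m + 4) 3 5 (m + 1) (by norm_num)
  have h4 := coeff_X_pow_mul_geom_pow_of_le (4 * m + 4) 4 5 (m + 1) (by norm_num)
  have h5 := coeff_X_pow_mul_geom_pow_of_le (4 * m + 4) 5 5 (m + 1) (by norm_num)
  rw [coeff_geom_pow, show 4 * m + 4 + (m + 1) = 5 * m + (4 + 1) by ring] at h0 h1 h2 h3 h4 h5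
  simp only [prod_range_succ, range_zero, prod_empty, Nat.reduceAdd, Nat.reduceSub] at hc h0 h1 h2 h3 h4 h5
  generalize ((5 * m + 5).choose (4 * m + 4)) = c at *
  generalize ((5 * m).choose m) = b at *
  generalize (#(supportDesign C (4 * (m + 1)))) = A at *
  push_cast at hc h0 h1 h2 h3 h4 h5
  have hP : (5 * m + 5 : ℝ) * (5 * m + 4) * (5 * m + 3) * (5 * m + 2) * (5 * m + 1) * (m + 1) ≠ 0 := by
    positivity
  refine mul_left_cancel₀ hP ?_
  linear_combination 4 * ((4 * m + 1) * (4 * m + 2) * (4 * m + 3) * (4 * m + 4)) * (m + 1) *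
    (((5 * m + 5 : ℝ) * (5 * m + 4) * (5 * m + 3) * (5 * m + 2) * (5 * m + 1)) * (h - hT) -
      (h0 - 19 * h1 - 494 * h2 - 494 * h3 - 19 * h4 + h5)) +
    (24 * m + 8) * (24 * m + 7) * (24 * m + 6) * (24 * m + 4) * (m + 1) * hc

set_option maxRecDepth 4000 in
/-- An extremal doubly even self-dual code of length `24m + 8` has `m < 159`: otherwise its number
of codewords of weight `4m + 8` would be negative. -/
theorem IsExtremalTypeII.lt_of_card_next (hC : IsExtremalTypeII C) : m < 159 := by
  by_contra! hm
  have hA := hC.card_min_eq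
  have h := hC.card_next
  have hc := choose_relation 8 2 m
  have hT := coeff_phi_pow_four_mul_jac (m + 2) (4 * m + 8)
  have hy := fun i hi => coeff_X_pow_mul_geom_pow_of_le (4 * m + 8) i 11 (m + 2) hi
  simp only [coeff_geom_pow, show 4 * m + 8 + (m + 2) = 5 * m + (8 + 2) by ring] at hy
  have hP : ∏ a ∈ range 11, (((m + 2 : ℕ) : ℝ) + ((4 * m + 8 : ℕ) : ℝ) - a) =
      5 * m * ∏ i ∈ range (8 + 2), ((5 * m : ℝ) + i + 1) := by
    simp only [prod_range_succ, range_zero, prod_empty, Nat.reduceAdd]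
    push_cast
    ring
  simp only [hP] at hy
  have hP0 : 0 < ∏ i ∈ range (8 + 2), ((5 * m : ℝ) + i + 1) :=
    Finset.prod_pos fun i _ => by positivity
  have hb : (0 : ℝ) < ((5 * m).choose m : ℕ) := by
    exact_mod_cast Nat.choose_pos (by omega)
  have hA2 : (0 : ℝ) ≤ (#(supportDesign C (4 * (m + 2))) : ℝ) := Nat.cast_nonneg _
  generalize ∏ i ∈ range (8 + 2), ((5 * m : ℝ) + i + 1) = P at *
  generalize ((5 * m + (8 + 2)).choose (4 * m + 8)) = c at *
  generalize (((5 * m).choose m : ℕ) : ℝ) = b at *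
  generalize (#(supportDesign C (4 * (m + 1))) : ℝ) = A at *
  generalize (#(supportDesign C (4 * (m + 2))) : ℝ) = A' at *
  have h0 := hy 0 (by norm_num)
  have h1 := hy 1 (by norm_num)
  have h2 := hy 2 (by norm_num)
  have h3 := hy 3 (by norm_num)
  have h4 := hy 4 (by norm_num)
  have h5 := hy 5 (by norm_num)
  have h6 := hy 6 (by norm_num)
  have h7 := hy 7 (by norm_num)
  have h8 := hy 8 (by norm_num)
  have h9 := hy 9 (by norm_num)
  have h10 := hy 10 (by norm_num)
  have h11 := hy 11 (by norm_num)
  clear hy hP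
  simp only [prod_range_succ, range_zero, prod_empty, Nat.reduceSub]
    at hc h0 h1 h2 h3 h4 h5 h6 h7 h8 h9 h10 h11
  push_cast at hc h0 h1 h2 h3 h4 h5 h6 h7 h8 h9 h10 h11
  generalize PowerSeries.coeff (m + 2) (phi ^ (1 + 3 * 1) * jac * geom ^ (4 * m + 8 + 1)) = T at *
  obtain ⟨s, hs, hm'⟩ : ∃ s : ℝ, 0 ≤ s ∧ (m : ℝ) = 159 + s :=
    ⟨((m - 159 : ℕ) : ℝ), Nat.cast_nonneg _, by push_cast [Nat.cast_sub hm]; ring⟩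
  generalize (m : ℝ) = m at *
  -- Q is the numerator of the residue T over the common denominator 5mP, with the coefficients of
  -- phi^4 · jac.
  obtain ⟨Q, hQ⟩ : ∃ Q : ℝ, Q =
    ((5 * m + 10) * (5 * m + 9) * (5 * m + 8) * (5 * m + 7) * (5 * m + 6) * (5 * m + 5) * (5 * m
      + 4) * (5 * m + 3) * (5 * m + 2) * (5 * m + 1) * (5 * m)) +
      23 * ((m + 2) * (5 * m + 9) * (5 * m + 8) * (5 * m + 7) * (5 * m + 6) * (5 * m + 5) * (5 *
      m + 4) * (5 * m + 3) * (5 * m + 2) * (5 * m + 1) * (5 * m)) -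
      701 * ((m + 2) * (m + 1) * (5 * m + 8) * (5 * m + 7) * (5 * m + 6) * (5 * m + 5) * (5 * m
      + 4) * (5 * m + 3) * (5 * m + 2) * (5 * m + 1) * (5 * m)) -
      29643 * ((m + 2) * (m + 1) * m * (5 * m + 7) * (5 * m + 6) * (5 * m + 5) * (5 * m + 4) *
      (5 * m + 3) * (5 * m + 2) * (5 * m + 1) * (5 * m)) -
      365862 * ((m + 2) * (m + 1) * m * (m - 1) * (5 * m + 6) * (5 * m + 5) * (5 * m + 4) * (5 *
      m + 3) * (5 * m + 2) * (5 * m + 1) * (5 * m)) -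
      1700970 * ((m + 2) * (m + 1) * m * (m - 1) * (m - 2) * (5 * m + 5) * (5 * m + 4) * (5 * m
      + 3) * (5 * m + 2) * (5 * m + 1) * (5 * m)) -
      1700970 * ((m + 2) * (m + 1) * m * (m - 1) * (m - 2) * (m - 3) * (5 * m + 4) * (5 * m + 3)
      * (5 * m + 2) * (5 * m + 1) * (5 * m)) -
      365862 * ((m + 2) * (m + 1) * m * (m - 1) * (m - 2) * (m - 3) * (m - 4) * (5 * m + 3) * (5
      * m + 2) * (5 * m + 1) * (5 * m)) -
      29643 * ((m + 2) * (m + 1) * m * (m - 1) * (m - 2) * (m - 3) * (m - 4) * (m - 5) * (5 * m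
      + 2) * (5 * m + 1) * (5 * m)) -
      701 * ((m + 2) * (m + 1) * m * (m - 1) * (m - 2) * (m - 3) * (m - 4) * (m - 5) * (m - 6) *
      (5 * m + 1) * (5 * m)) +
      23 * ((m + 2) * (m + 1) * m * (m - 1) * (m - 2) * (m - 3) * (m - 4) * (m - 5) * (m - 6) *
      (m - 7) * (5 * m)) +
      ((m + 2) * (m + 1) * m * (m - 1) * (m - 2) * (m - 3) * (m - 4) * (m - 5) * (m - 6) * (m -
      7) * (m - 8)) := ⟨_, rfl⟩
  have hTQ : 5 * m * P * T = Q * c := by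
    rw [hQ]
    linear_combination 5 * m * P * hT + h0 + 23 * h1 - 701 * h2 - 29643 * h3 - 365862 * h4 -
      1700970 * h5 - 1700970 * h6 - 365862 * h7 - 29643 * h8 - 701 * h9 + 23 * h10 + h11
  clear h0 h1 h2 h3 h4 h5 h6 h7 h8 h9 h10 h11 hT
  obtain ⟨R, hR⟩ : ∃ R : ℝ, R = (24 * m + 8) * (24 * m + 7) * (24 * m + 6) * (24 * m + 4) *
    ((4 * m + 5) * (4 * m + 6) * (4 * m + 7) * (4 * m + 8)) *
    ((m + 8) * (m + 1) * (m + 2) * (5 * m)) := ⟨_, rfl⟩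
  -- After the substitution m = 159 + s, the expansion in s ≥ 0 is visibly positive.
  have hQR : 0 < Q + R := by
    rw [hQ, hR, hm']
    ring_nf
    positivity
  have hm0 : 0 < m := by rw [hm']; positivity
  -- This is T + (4m + 32)A + A' = 0 with denominators cleared: Q comes from T and R from the
  -- minimum weight words, so A' would have to be negative.
  have key : P * b * (Q + R) + A' * (5 * m * P * ((4 * m + 1) * (4 * m + 2) * (4 * m + 3) *
      (4 * m + 4) * (4 * m + 5) * (4 * m + 6) * (4 * m + 7) * (4 * m + 8)) * ((m + 1) * (m + 2))) =
      0 := by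
    rw [hR]
    linear_combination (5 * m * P * ((4 * m + 1) * (4 * m + 2) * (4 * m + 3) *
      (4 * m + 4) * (4 * m + 5) * (4 * m + 6) * (4 * m + 7) * (4 * m + 8)) * ((m + 1) * (m + 2))) *
      h - ((4 * m + 1) * (4 * m + 2) * (4 * m + 3) * (4 * m + 4) * (4 * m + 5) * (4 * m + 6) *
      (4 * m + 7) * (4 * m + 8)) * ((m + 1) * (m + 2)) * hTQ - Q * hc -
      ((m + 8) * (5 * m * P) * ((4 * m + 5) * (4 * m + 6) * (4 * m + 7) * (4 * m + 8)) *
      ((m + 1) * (m + 2))) * hA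
  have h1 : 0 < P * b * (Q + R) := by positivity
  have h2 : 0 ≤ A' * (5 * m * P * ((4 * m + 1) * (4 * m + 2) * (4 * m + 3) *
      (4 * m + 4) * (4 * m + 5) * (4 * m + 6) * (4 * m + 7) * (4 * m + 8)) *
      ((m + 1) * (m + 2))) := by
    positivity
  linarith

end WeightDistribution

end SupportDesign

namespace SupportDesign

/-! ### The finite check -/

section Arithmetic

/-- The numerical condition under which the minimum weight codewords can form a `4`-design. -/
def admissible (m b : ℕ) : Bool := (6 * m + 1) * b % (24 * m + 5) == 0

/-- No numerical obstruction to a `{1, …, 6, 8}`-design of the minimum weight codewords. -/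
def admissibleEight (m b : ℕ) : Bool :=
  m * (4 * m - 1) * b % ((24 * m + 5) * (24 * m + 3)) == 0 &&
    (4 * m - 3) * (24 * m - 6) * (4 * m - 2) * (m * (4 * m - 1) * b) % (24 * m + 1) == 0

/-- Covers 1 ≤ m ≤ 158. The binomial coefficient is written through falling factorials so that the
kernel can evaluate it quickly. -/
theorem list_check : (List.range 158).all (fun p =>
    let m := p + 1
    let b := (5 * m).descFactorial m / m.factorial
    !admissible m b || (!admissibleEight m b &&
      (List.range (4 * m + 1)).all fun j => factorSix m j != 0 && factorEight m j != 0)) = true := by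
  decide +kernel

theorem admissible_check {m : ℕ} (h0 : m ≠ 0) (hm : m < 159)
    (h : 24 * m + 5 ∣ (6 * m + 1) * (5 * m).choose m) :
    admissibleEight m ((5 * m).choose m) = false ∧
      ∀ j ≤ 4 * m, factorSix m j ≠ 0 ∧ factorEight m j ≠ 0 := by
  have h1 := List.all_eq_true.1 list_check (m - 1) (List.mem_range.2 (by omega))
  simp only [show m - 1 + 1 = m by omega, ← Nat.choose_eq_descFactorial_div_factorial] at h1
  have h2 : admissible m ((5 * m).choose m) = true := by
    rw [admissible, beq_iff_eq]
    exact Nat.mod_eq_zero_of_dvd h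
  rw [h2, Bool.not_true, Bool.false_or, Bool.and_eq_true, Bool.not_eq_true', List.all_eq_true] at h1
  refine ⟨h1.1, fun j hj => ?_⟩
  have h3 := h1.2 j (List.mem_range.2 (by omega))
  simpa using h3

end Arithmetic

/-! ### Simultaneity and exceptional weights -/

section Main

variable {m : ℕ} {C : Submodule (ZMod 2) (Fin (24 * m + 8) → ZMod 2)}

theorem isDesignWeight_iff {w : ℕ} :
    IsDesignWeight (24 * m + 8) w ↔ ∃ j ≤ 4 * m, w = 4 * m + 4 + 4 * j := by
  unfold IsDesignWeight
  rw [show (24 * m + 8) / 24 = m by omega]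
  constructor
  · rintro ⟨⟨r, rfl⟩, h1, h2⟩
    exact ⟨r - m - 1, by omega, by omega⟩
  · rintro ⟨j, hj, rfl⟩
    exact ⟨⟨m + 1 + j, by ring⟩, by omega, by omega⟩

/-- All block sums of harmonic functions of degree `k` vanish. -/
def Vanishes (C : Submodule (ZMod 2) (Fin (24 * m + 8) → ZMod 2)) (k : ℕ) : Prop :=
  ∀ f : Finset (Fin (24 * m + 8)) → ℝ, IsHarmonic k f → ∀ j ≤ 4 * m, blockSum C k f j = 0

/-- One weight with nonzero factor determines the scalar r, which is shared by all weights. -/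
theorem vanishes_of_factor_ne_zero {k : ℕ} {g : ℕ → ℤ}
    (hs : ∀ f : Finset (Fin (24 * m + 8)) → ℝ, IsHarmonic k f →
      ∃ r : ℝ, ∀ j ≤ 4 * m, ∃ c : ℝ, c ≠ 0 ∧ blockSum C k f j = r * (c * g j))
    {j : ℕ} (hj : j ≤ 4 * m) (hg : g j ≠ 0)
    (h : ∀ f : Finset (Fin (24 * m + 8)) → ℝ, IsHarmonic k f → blockSum C k f j = 0) :
    Vanishes C k := by
  intro f hf i hi
  obtain ⟨r, hr⟩ := hs f hf
  obtain ⟨c, hc, hj'⟩ := hr j hj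
  obtain ⟨d, -, hi'⟩ := hr i hi
  rw [h f hf, eq_comm, mul_eq_zero] at hj'
  rcases hj' with h0 | h0
  · rw [hi', h0, zero_mul]
  · exact absurd h0 (mul_ne_zero hc (Int.cast_ne_zero.2 hg))

theorem IsExtremalTypeII.vanishes_low (hC : IsExtremalTypeII C) {k : ℕ}
    (hk : k = 1 ∨ k = 2 ∨ k = 3 ∨ k = 5) : Vanishes C k := by
  intro f hf j hj
  rcases (show k < 4 ∨ k = 5 by omega) with h | rfl
  · exact hC.blockSum_of_lt_four (by omega) h hf hj
  rcases eq_or_ne m 0 with rfl | hm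
  · refine Finset.sum_eq_zero fun B hB => extend_of_card_lt f ?_
    rw [card_of_mem_supportDesign B hB]
    omega
  · exact hC.blockSum_five hm hf hj

theorem IsExtremalTypeII.blockSum_seven_middle (hC : IsExtremalTypeII C)
    {f : Finset (Fin (24 * m + 8)) → ℝ} (hf : IsHarmonic 7 f) : blockSum C 7 f (2 * m) = 0 := by
  rcases eq_or_ne m 0 with rfl | hm
  -- For m = 0 the blocks have 4 points and contain no 7-subsets.
  · refine Finset.sum_eq_zero fun B hB => extend_of_card_lt f ?_
    rw [card_of_mem_supportDesign B hB]
    norm_num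
  · obtain ⟨r, hr⟩ := hC.blockSum_seven hm hf
    obtain ⟨c, -, h⟩ := hr (2 * m) (by omega)
    rw [h, factorSeven]
    push_cast
    ring

theorem factorSeven_ne_zero (hm : m ≠ 0) {j : ℕ} (hj : j ≤ 4 * m) (hj' : j ≠ 2 * m) :
    factorSeven m j ≠ 0 := by
  have h1 : (1 : ℤ) ≤ m := by omega
  have h2 : (0 : ℤ) ≤ 4 * m - j := by omega
  refine mul_ne_zero (by omega) (ne_of_gt ?_)
  have h3 : (0 : ℤ) < (4 * m - 1) * (4 * m - 2) := mul_pos (by omega) (by omega)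
  positivity

theorem IsExtremalTypeII.isDesign_of_vanishes {t : ℕ} (ht : t ≤ 4 * m + 4)
    (h : ∀ k, 1 ≤ k → k ≤ t → Vanishes C k) {j : ℕ} (hj : j ≤ 4 * m) :
    IsDesign t (4 * m + 4 + 4 * j) (supportDesign C (4 * m + 4 + 4 * j)) :=
  isDesign_of_harmonic card_of_mem_supportDesign (by omega) fun k h1 h2 f hf => h k h1 h2 f hf j hj

theorem blockSum_eq_zero_of_isDesign {t k j : ℕ} (ht : t ≤ 4 * m + 4)
    (h : IsDesign t (4 * m + 4 + 4 * j) (supportDesign C (4 * m + 4 + 4 * j))) (hk : k ≠ 0)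
    (hkt : k ≤ t) (f : Finset (Fin (24 * m + 8)) → ℝ) (hf : IsHarmonic k f) :
    blockSum C k f j = 0 :=
  h.sum_extend_eq_zero hk hkt (by omega) hf

/-- The parameters of a design of minimum weight codewords, in terms of falling factorials. -/
theorem IsExtremalTypeII.design_param (hC : IsExtremalTypeII C) {t l : ℕ}
    (hl : ∀ S : Finset (Fin (24 * m + 8)), #S = t →
      #{B ∈ supportDesign C (4 * m + 4) | S ⊆ B} = l) :
    (l : ℝ) * (24 * m + 8).descFactorial t *
      (4 * ((4 * m + 1) * (4 * m + 2) * (4 * m + 3) * (4 * m + 4))) =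
      (24 * m + 8) * (24 * m + 7) * (24 * m + 6) * (24 * m + 4) * ((5 * m).choose m : ℕ) *
        (4 * m + 4).descFactorial t := by
  have h1 := card_mul_choose card_of_mem_supportDesign hl
  rw [Fintype.card_fin] at h1
  have h2 := hC.card_min_eq
  rw [show 4 * (m + 1) = 4 * m + 4 by ring] at h2
  have h3 := congrArg (Nat.cast : ℕ → ℝ) h1
  rw [Nat.descFactorial_eq_factorial_mul_choose, Nat.descFactorial_eq_factorial_mul_choose]
  push_cast only [Nat.cast_mul] at h3 ⊢
  linear_combination (t.factorial : ℝ) *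
    (4 * ((4 * m + 1) * (4 * m + 2) * (4 * m + 3) * (4 * m + 4))) * h3 +
    (t.factorial : ℝ) * ((4 * m + 4).choose t : ℝ) * h2

/-- The minimum weight words form a 4-design, and its parameter l equals (6m+1) C(5m, m) / (24m+5).
-/
theorem IsExtremalTypeII.dvd_of_vanishes_four (hC : IsExtremalTypeII C) (h4 : Vanishes C 4) :
    24 * m + 5 ∣ (6 * m + 1) * (5 * m).choose m := by
  have hV : ∀ k, 1 ≤ k → k ≤ 4 → Vanishes C k := by
    intro k h1 h2
    interval_cases k
    exacts [hC.vanishes_low (by norm_num), hC.vanishes_low (by norm_num),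
      hC.vanishes_low (by norm_num), h4]
  obtain ⟨-, l, hl⟩ := IsExtremalTypeII.isDesign_of_vanishes (by omega) hV (Nat.zero_le _)
  have h := hC.design_param hl
  simp only [Nat.descFactorial_succ, Nat.descFactorial_zero, Nat.reduceSubDiff, mul_one,
    Nat.sub_zero, Nat.cast_mul] at h
  push_cast at h
  refine ⟨l, ?_⟩
  have hX : (24 * m + 8 : ℝ) * (24 * m + 7) * (24 * m + 6) *
    ((4 * m + 1) * (4 * m + 2) * (4 * m + 3) * (4 * m + 4)) * 4 ≠ 0 := by positivity
  have : ((6 * m + 1) * ((5 * m).choose m : ℕ) : ℝ) = (24 * m + 5) * l := by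
    refine mul_left_cancel₀ hX ?_
    linear_combination -h
  exact_mod_cast this

/-- Degree 7 is not needed: the minimum weight words form a 6-design with vanishing degree 8, and
`IsDesign.cov_add_two` still expresses covering numbers of 8-sets through those of 7-sets.
Integrality of the covering numbers contradicts the finite check. -/
theorem IsExtremalTypeII.not_vanishes_eight (hC : IsExtremalTypeII C) (hm : m ≠ 0)
    (h4 : Vanishes C 4) (h6 : Vanishes C 6) (h8 : Vanishes C 8) : False := by
  have hV : ∀ k, 1 ≤ k → k ≤ 6 → Vanishes C k := by
    intro k h1 h2
    interval_cases k
    exacts [hC.vanishes_low (by norm_num), hC.vanishes_low (by norm_num),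
      hC.vanishes_low (by norm_num), h4, hC.vanishes_low (by norm_num), h6]
  obtain ⟨-, l, hl⟩ := IsExtremalTypeII.isDesign_of_vanishes (by omega) hV (Nat.zero_le _)
  have hch := (admissible_check hm hC.lt_of_card_next (hC.dvd_of_vanishes_four h4)).1
  obtain ⟨p, rfl⟩ : ∃ p, m = p + 1 := ⟨m - 1, by omega⟩
  have h := hC.design_param hl
  have hl6 : ((p + 1) * (4 * p + 3)) * (5 * (p + 1)).choose (p + 1) =
      ((24 * p + 29) * (24 * p + 27)) * l := by
    rw [show 24 * (p + 1) + 8 = 24 * p + 32 by ring, show 4 * (p + 1) + 4 = 4 * p + 8 by ring] at h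
    simp only [Nat.descFactorial_succ, Nat.descFactorial_zero, Nat.reduceSubDiff, mul_one,
      Nat.sub_zero, Nat.cast_mul] at h
    push_cast at h
    have hX : (24 * p + 32 : ℝ) * (24 * p + 31) * (24 * p + 30) * (24 * p + 28) *
      ((4 * p + 5) * (4 * p + 6) * (4 * p + 7) * (4 * p + 8)) * 4 ≠ 0 := by positivity
    have : (((p + 1) * (4 * p + 3)) * ((5 * (p + 1)).choose (p + 1) : ℕ) : ℝ) =
        ((24 * p + 29) * (24 * p + 27)) * l := by
      refine mul_left_cancel₀ hX ?_
      linear_combination -h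
    exact_mod_cast this
  obtain ⟨S, -, hS⟩ := exists_subset_card_eq (s := (univ : Finset (Fin (24 * (p + 1) + 8)))) (n := 8)
    (by rw [card_univ, Fintype.card_fin]; omega)
  have hcov := IsDesign.cov_add_two (k := 6) (w := 4 * (p + 1) + 4 + 4 * 0)
    card_of_mem_supportDesign hl (by omega) (by rw [Fintype.card_fin]; omega)
    (fun f hf => h8 f hf 0 (Nat.zero_le _)) (n := 24 * p + 32)
    (L := (4 * p + 2) * l / (24 * p + 26)) (by rw [Fintype.card_fin]; push_cast; ring)
    (by
      have : (24 * p + 26 : ℝ) ≠ 0 := by positivity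
      push_cast
      field_simp
      ring) S hS
  set μ := cov (supportDesign C (4 * (p + 1) + 4 + 4 * 0)) S
  have hsum : ∑ i ∈ S, (cov (supportDesign C (4 * (p + 1) + 4 + 4 * 0)) (S.erase i) : ℝ) =
      ((∑ i ∈ S, cov (supportDesign C (4 * (p + 1) + 4 + 4 * 0)) (S.erase i) : ℕ) : ℝ) := by
    push_cast; rfl
  rw [hsum] at hcov
  set M := ∑ i ∈ S, cov (supportDesign C (4 * (p + 1) + 4 + 4 * 0)) (S.erase i)
  have hdvd : ((24 * p + 25 : ℕ) : ℤ) ∣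
      (((4 * p + 1) * (24 * p + 18) * (4 * p + 2) * l : ℕ) : ℤ) := by
    -- Here L = (4p+2) l / (24p+26) is the mean covering number of 7-sets; clearing its denominator
    -- isolates one term not visibly divisible by n - 7 = 24p + 25.
    refine ⟨(24 * p + 18) * (24 * p + 26) * μ -
      (4 * p + 1) * ((24 * p + 26) * M - 8 * ((4 * p + 2) * l)), ?_⟩
    have hX : (24 * p + 26 : ℝ) ≠ 0 := by positivity
    have : ((4 * p + 1) * (24 * p + 18) * (4 * p + 2) * l : ℝ) =
        (24 * p + 25) * ((24 * p + 18) * (24 * p + 26) * μ -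
          (4 * p + 1) * ((24 * p + 26) * M - 8 * ((4 * p + 2) * l))) := by
      push_cast at hcov
      field_simp at hcov
      linear_combination -hcov
    exact_mod_cast this
  rw [Int.natCast_dvd_natCast] at hdvd
  have : admissibleEight (p + 1) ((5 * (p + 1)).choose (p + 1)) = true := by
    unfold admissibleEight
    rw [show 4 * (p + 1) - 1 = 4 * p + 3 by omega, show 4 * (p + 1) - 3 = 4 * p + 1 by omega,
      show 24 * (p + 1) - 6 = 24 * p + 18 by omega, show 4 * (p + 1) - 2 = 4 * p + 2 by omega,
      show 24 * (p + 1) + 1 = 24 * p + 25 by ring, show 24 * (p + 1) + 5 = 24 * p + 29 by ring,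
      show 24 * (p + 1) + 3 = 24 * p + 27 by ring, Bool.and_eq_true, beq_iff_eq, beq_iff_eq, hl6]
    refine ⟨Nat.mul_mod_right _ _, Nat.mod_eq_zero_of_dvd ?_⟩
    -- The check uses m(4m-1) C(5m, m), which is l times (24m+5)(24m+3), so the divisibility
    -- obtained for l is more than enough.
    rw [show (4 * p + 1) * (24 * p + 18) * (4 * p + 2) * ((24 * p + 29) * (24 * p + 27) * l) =
      (4 * p + 1) * (24 * p + 18) * (4 * p + 2) * l * ((24 * p + 29) * (24 * p + 27)) by ring]
    exact hdvd.mul_right _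
  rw [this] at hch
  exact absurd hch (by decide)

theorem IsExtremalTypeII.vanishes_four (hC : IsExtremalTypeII C) (hm : m ≠ 0) {t j : ℕ}
    (hj : j ≤ 4 * m) (ht4 : 4 ≤ t) (ht : t ≤ 8)
    (h : IsDesign t (4 * m + 4 + 4 * j) (supportDesign C (4 * m + 4 + 4 * j))) : Vanishes C 4 :=
  vanishes_of_factor_ne_zero (g := fun _ => 1) (fun _ hf => hC.blockSum_four hf) hj one_ne_zero
    (blockSum_eq_zero_of_isDesign (by omega) h (by norm_num) ht4)

theorem IsExtremalTypeII.vanishes_six (hC : IsExtremalTypeII C) (hm : m ≠ 0) {t j : ℕ}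
    (hj : j ≤ 4 * m) (ht6 : 6 ≤ t) (ht : t ≤ 8)
    (h : IsDesign t (4 * m + 4 + 4 * j) (supportDesign C (4 * m + 4 + 4 * j))) : Vanishes C 6 :=
  vanishes_of_factor_ne_zero (fun _ hf => hC.blockSum_six hm hf) hj
    ((admissible_check hm hC.lt_of_card_next
      (hC.dvd_of_vanishes_four (hC.vanishes_four hm hj (by omega) ht h))).2 j hj).1
    (blockSum_eq_zero_of_isDesign (by omega) h (by norm_num) ht6)

theorem IsExtremalTypeII.vanishes_seven (hC : IsExtremalTypeII C) (hm : m ≠ 0) {t j : ℕ}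
    (hj : j ≤ 4 * m) (hj' : j ≠ 2 * m) (ht7 : 7 ≤ t) (ht : t ≤ 8)
    (h : IsDesign t (4 * m + 4 + 4 * j) (supportDesign C (4 * m + 4 + 4 * j))) : Vanishes C 7 :=
  vanishes_of_factor_ne_zero (fun _ hf => hC.blockSum_seven hm hf) hj
    (factorSeven_ne_zero hm hj hj')
    (blockSum_eq_zero_of_isDesign (by omega) h (by norm_num) ht7)

theorem IsExtremalTypeII.vanishes_eight (hC : IsExtremalTypeII C) (hm : m ≠ 0) {j : ℕ}
    (hj : j ≤ 4 * m)
    (h : IsDesign 8 (4 * m + 4 + 4 * j) (supportDesign C (4 * m + 4 + 4 * j))) : Vanishes C 8 :=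
  vanishes_of_factor_ne_zero (fun _ hf => hC.blockSum_eight hm hf) hj
    ((admissible_check hm hC.lt_of_card_next
      (hC.dvd_of_vanishes_four (hC.vanishes_four hm hj (by omega) le_rfl h))).2 j hj).2
    (blockSum_eq_zero_of_isDesign (by omega) h (by norm_num) le_rfl)

theorem simultaneously_of_forall {n t : ℕ} {C : Submodule (ZMod 2) (Fin n → ZMod 2)} {S : Set ℕ}
    (h : ∀ w ∈ S, IsDesign t w (supportDesign C w) → ∀ v ∈ S, IsDesign t v (supportDesign C v)) :
    Simultaneously C t S := by
  by_cases h0 : ∃ w ∈ S, IsDesign t w (supportDesign C w)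
  · obtain ⟨w, hw, hd⟩ := h0
    exact Or.inl (h w hw hd)
  · exact Or.inr fun w hw hd => h0 ⟨w, hw, hd⟩

theorem IsExtremalTypeII.simultaneously_six (hC : IsExtremalTypeII C) :
    Simultaneously C 6 {w | IsDesignWeight (24 * m + 8) w} := by
  refine simultaneously_of_forall fun w hw hd v hv => ?_
  obtain ⟨j, hj, rfl⟩ := isDesignWeight_iff.1 hw
  obtain ⟨i, hi, rfl⟩ := isDesignWeight_iff.1 hv
  rcases eq_or_ne m 0 with rfl | hm
  · rwa [show i = j by omega]
  refine IsExtremalTypeII.isDesign_of_vanishes (by omega) (fun k h1 h2 => ?_) hi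
  interval_cases k
  exacts [hC.vanishes_low (by norm_num), hC.vanishes_low (by norm_num),
    hC.vanishes_low (by norm_num), hC.vanishes_four hm hj (by norm_num) (by norm_num) hd,
    hC.vanishes_low (by norm_num), hC.vanishes_six hm hj (by norm_num) (by norm_num) hd]

theorem IsExtremalTypeII.simultaneously_seven (hC : IsExtremalTypeII C) :
    Simultaneously C 7 {w | IsDesignWeight (24 * m + 8) w ∧ w ≠ 12 * m + 4} := by
  refine simultaneously_of_forall fun w hw hd v hv => ?_
  obtain ⟨j, hj, rfl⟩ := isDesignWeight_iff.1 hw.1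
  obtain ⟨i, hi, rfl⟩ := isDesignWeight_iff.1 hv.1
  have hj' : j ≠ 2 * m := by
    have := hw.2
    omega
  rcases eq_or_ne m 0 with rfl | hm
  · omega
  refine IsExtremalTypeII.isDesign_of_vanishes (by omega) (fun k h1 h2 => ?_) hi
  interval_cases k
  exacts [hC.vanishes_low (by norm_num), hC.vanishes_low (by norm_num),
    hC.vanishes_low (by norm_num), hC.vanishes_four hm hj (by norm_num) (by norm_num) hd,
    hC.vanishes_low (by norm_num), hC.vanishes_six hm hj (by norm_num) (by norm_num) hd,
    hC.vanishes_seven hm hj hj' le_rfl (by norm_num) hd]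

/-- For m > 0 none of the designs is an 8-design; for m = 0 there is only one design. -/
theorem IsExtremalTypeII.simultaneously_eight (hC : IsExtremalTypeII C) :
    Simultaneously C 8 {w | IsDesignWeight (24 * m + 8) w} := by
  refine simultaneously_of_forall fun w hw hd v hv => ?_
  obtain ⟨j, hj, rfl⟩ := isDesignWeight_iff.1 hw
  obtain ⟨i, hi, rfl⟩ := isDesignWeight_iff.1 hv
  rcases eq_or_ne m 0 with rfl | hm
  · rwa [show i = j by omega]
  exact (hC.not_vanishes_eight hm (hC.vanishes_four hm hj (by norm_num) le_rfl hd)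
    (hC.vanishes_six hm hj (by norm_num) le_rfl hd) (hC.vanishes_eight hm hj hd)).elim

theorem IsExtremalTypeII.isTDesign_low (hC : IsExtremalTypeII C) {w : ℕ}
    (hw : IsDesignWeight (24 * m + 8) w) : IsTDesign {1, 2, 3, 5} w (supportDesign C w) := by
  obtain ⟨j, hj, rfl⟩ := isDesignWeight_iff.1 hw
  refine ⟨card_of_mem_supportDesign, fun k hk f hf => hC.vanishes_low ?_ f hf j hj⟩
  simpa using hk

theorem IsExtremalTypeII.isTDesign_insert (hC : IsExtremalTypeII C) {j k : ℕ} (hj : j ≤ 4 * m)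
    (hk : ∀ f : Finset (Fin (24 * m + 8)) → ℝ, IsHarmonic k f → blockSum C k f j = 0) :
    IsTDesign {1, 2, 3, 5, k} (4 * m + 4 + 4 * j) (supportDesign C (4 * m + 4 + 4 * j)) := by
  refine ⟨card_of_mem_supportDesign, fun i hi f hf => ?_⟩
  have hi' : (i = 1 ∨ i = 2 ∨ i = 3 ∨ i = 5) ∨ i = k := by
    simp only [Set.mem_insert_iff, Set.mem_singleton_iff] at hi
    tauto
  rcases hi' with h | rfl
  · exact hC.vanishes_low h f hf j hj
  · exact hk f hf

end Main

end SupportDesign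

theorem mainTheorem6 (m : ℕ) (C : Submodule (ZMod 2) (Fin (24 * m + 8) → ZMod 2))
    (hC : SupportDesign.IsExtremalTypeII C) :
    -- degree 6
    ((m ≠ 4 →
        SupportDesign.Simultaneously C 6 {w | SupportDesign.IsDesignWeight (24 * m + 8) w}) ∧
      (m = 4 →
        (∀ w, SupportDesign.IsDesignWeight (24 * m + 8) w → w ≠ 24 →
          SupportDesign.IsTDesign {1, 2, 3, 5} w (SupportDesign.supportDesign C w)) ∧
        SupportDesign.IsTDesign {1, 2, 3, 5, 6} 24 (SupportDesign.supportDesign C 24))) ∧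
    -- degree 7
    (SupportDesign.Simultaneously C 7
        {w | SupportDesign.IsDesignWeight (24 * m + 8) w ∧ w ≠ 12 * m + 4} ∧
      SupportDesign.IsTDesign {1, 2, 3, 5, 7} (12 * m + 4)
        (SupportDesign.supportDesign C (12 * m + 4))) ∧
    -- degree 8
    ((m ≠ 8 →
        SupportDesign.Simultaneously C 8 {w | SupportDesign.IsDesignWeight (24 * m + 8) w}) ∧
      (m = 8 →
        (∀ w, SupportDesign.IsDesignWeight (24 * m + 8) w → w ≠ 40 →
          SupportDesign.IsTDesign {1, 2, 3, 5} w (SupportDesign.supportDesign C w)) ∧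
        SupportDesign.IsTDesign {1, 2, 3, 5, 8} 40 (SupportDesign.supportDesign C 40))) := by
  refine ⟨⟨fun _ => hC.simultaneously_six, ?_⟩, ⟨hC.simultaneously_seven, ?_⟩,
    ⟨fun _ => hC.simultaneously_eight, ?_⟩⟩
  · rintro rfl
    -- Weight 24 is 4m + 4 + 4j with m = 4 and j = 1, a zero of `factorSix`.
    refine ⟨fun w hw _ => hC.isTDesign_low hw, hC.isTDesign_insert (j := 1) (by norm_num) ?_⟩
    intro f hf
    obtain ⟨r, hr⟩ := hC.blockSum_six (by norm_num) hf
    obtain ⟨c, -, h⟩ := hr 1 (by norm_num)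
    rw [h, show SupportDesign.factorSix 4 1 = 0 by decide]
    simp
  · have h := hC.isTDesign_insert (j := 2 * m) (by omega) fun f hf => hC.blockSum_seven_middle hf
    rwa [show 4 * m + 4 + 4 * (2 * m) = 12 * m + 4 by ring] at h
  · rintro rfl
    -- Weight 40 is 4m + 4 + 4j with m = 8 and j = 1, a zero of `factorEight`.
    refine ⟨fun w hw _ => hC.isTDesign_low hw, hC.isTDesign_insert (j := 1) (by norm_num) ?_⟩
    intro f hf
    obtain ⟨r, hr⟩ := hC.blockSum_eight (by norm_num) hf
    obtain ⟨c, -, h⟩ := hr 1 (by norm_num)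
    rw [h, show SupportDesign.factorEight 8 1 = 0 by decide]
    simp
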